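/- Let $\mathbb T=\mathbb R/2\pi\mathbb Z$. For every $\nu>0$ there is an infinite family $\mathcal A$ of smooth functions $h_0:\mathbb T\to\mathbb R$ such that the following holds for every $h_0\in\mathcal A$. 1. $\int_{\mathbb T}h_0(x)\,dx=0$ and $\|\partial_xh_0\|_{L^\infty(\mathbb T)}<1$. 2. There is $t_0>0$, depending on $h_0$, such that the solution $h$ of $$h_t=(h_x^3-h_x)_x-\nu h_{xxxx}\quad\text{on }\mathbb T,\qquad h(0,\cdot)=h_0,$$ exists beyond the time $t_0$ and satisfies $\|\partial_xh(t_0,\cdot)\|_{L^\infty(\mathbb T)}>1$. That is, a classical solution exists on $[0,T)\times\mathbb T$ for some $T>t_0$, and every classical solution on $[0,T)\times\mathbb T$ with $T>t_0$ satisfies this inequality. (A classical solution on $[0,T)\times\mathbb T$ is one for which $\partial_th$ and $\partial_x^kh$, $0\le k\le4$, exist and are continuous on $[0,T)\times\mathbb T$, with $\partial_t$ one-sided at $t=0$, and the equation holds pointwise.) -/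

import Mathlib

open scoped ENNReal ContDiff

noncomputable section

/-- The norm of `L^∞(𝕋)`, `𝕋 = ℝ / 2πℤ`, of a `2π`-periodic function on `ℝ`, computed on the
fundamental domain `(-π, π]`. -/
def torusLInfNorm (f : ℝ → ℝ) : ℝ≥0∞ :=
  MeasureTheory.eLpNorm f ∞
    (MeasureTheory.volume.restrict (Set.Ioc (-Real.pi) Real.pi))

/-- The right-hand side `(u_x³ - u_x)_x - ν u_xxxx` of the equation, at a function `u` of `x`. -/
def thinFilmRHS (ν : ℝ) (u : ℝ → ℝ) (x : ℝ) : ℝ :=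
  deriv (fun y => (deriv u y) ^ 3 - deriv u y) x - ν * iteratedDeriv 4 u x

/-- `h` (first argument time, second argument space) is a classical `2π`-periodic solution of
`h_t = (h_x³ - h_x)_x - ν h_xxxx` on `[0, T)` with initial datum `h₀`. The spatial derivatives of
order at most four exist and are jointly continuous up to `t = 0`. The time derivative is
one-sided at `t = 0`; it is jointly continuous by the equation. Values of `h` at times outside
`[0, T)` play no role. -/
structure IsClassicalSolution (ν T : ℝ) (h₀ : ℝ → ℝ) (h : ℝ → ℝ → ℝ) : Prop where
  periodic : ∀ t ∈ Set.Ico 0 T, Function.Periodic (h t) (2 * Real.pi)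
  contDiff : ∀ t ∈ Set.Ico 0 T, ContDiff ℝ 4 (h t)
  continuousOn : ∀ k : ℕ, k ≤ 4 →
    ContinuousOn (fun p : ℝ × ℝ => iteratedDeriv k (h p.1) p.2) (Set.Ico 0 T ×ˢ Set.univ)
  equation : ∀ t ∈ Set.Ico 0 T, ∀ x : ℝ,
    HasDerivWithinAt (fun s => h s x) (thinFilmRHS ν (h t) x) (Set.Ici 0) t
  initial : ∀ x : ℝ, h 0 x = h₀ x

end

open MeasureTheory Set Filter Topology
open scoped lp

/-! The slope `u = h_x` solves `u_t = (u³ - u)_xx - ν u_xxxx`, and the fourth-order term admits no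
maximum principle. Take a slope `q` with maximum `1` at `0`, where `q'' = 0` and `q'''' < 0`;
`flatSlopeProfile` has `q = (9 cos x - cos 3x) / 8`. At the origin `(q³ - q)_xx` vanishes and `-ν
q'''' = 9ν > 0`, so the slope there rises above `1` at once (`IsMildSolution.tsum_modeRate_initial`,
`IsMildSolution.exists_one_lt_cosEval`). Fix such a time `t₀`. The datum with slope `s q`, `s < 1`,
has slope at most `s`, and for `s` near `1` continuous dependence keeps the slope at `(t₀, 0)` above
`1`. These `s` give the infinite family.

Existence on a common time interval and Lipschitz dependence both come from a contraction
(`exists_isMildSolution`) in a weighted `ℓ¹` space of cosine coefficients with values in `C([0,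
T])`. The weight `(1 + |k|)^4` is submultiplicative, so the cube is locally Lipschitz, and it
absorbs the four derivatives in the slope equation. Keeping the time supremum inside the sum
supplies time-independent majorants, so every series can be differentiated termwise and mild
solutions are classical (`IsMildSolution.isClassicalSolution`). An `L²` energy estimate
(`IsClassicalSolution.unique`) carries the conclusion to every classical solution. -/

noncomputable section

/-! ### Uniqueness of classical solutions by an energy estimate. -/

section Uniqueness

theorem hasDerivAt_iteratedDeriv_of_contDiff {u : ℝ → ℝ} {n : ℕ} (hu : ContDiff ℝ n u) {j : ℕ}
    (hj : j < n) (x : ℝ) : HasDerivAt (iteratedDeriv j u) (iteratedDeriv (j + 1) u x) x := by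
  rw [iteratedDeriv_succ]
  exact (hu.differentiable_iteratedDeriv j (by exact_mod_cast hj) x).hasDerivAt

theorem thinFilmRHS_eq (ν : ℝ) {u : ℝ → ℝ} (hu : ContDiff ℝ 4 u) (x : ℝ) :
    thinFilmRHS ν u x = (3 * iteratedDeriv 1 u x ^ 2 - 1) * iteratedDeriv 2 u x
      - ν * iteratedDeriv 4 u x := by
  have h1 := hasDerivAt_iteratedDeriv_of_contDiff (n := 4) hu (j := 1) (by norm_num) x
  have h2 := (h1.pow 3).sub h1
  unfold thinFilmRHS
  have e : deriv u = iteratedDeriv 1 u := iteratedDeriv_one.symm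
  rw [e, show (fun y => iteratedDeriv 1 u y ^ 3 - iteratedDeriv 1 u y)
    = iteratedDeriv 1 u ^ 3 - iteratedDeriv 1 u from rfl, h2.deriv]
  norm_num
  ring

theorem Function.Periodic.iteratedDeriv {u : ℝ → ℝ} {p : ℝ} (hu : Function.Periodic u p) (j : ℕ) :
    Function.Periodic (iteratedDeriv j u) p := by
  intro x
  have h := iteratedDeriv_comp_add_const j u p
  rw [show (fun z => u (z + p)) = u from funext hu] at h
  exact (congrFun h x).symm

/-- With `w = u - v`, integration by parts leaves `-2 w_x (u_x³ - v_x³) - 2 w w_xx - 2ν w_xx²`. The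
first term is nonpositive since the cube is monotone; completing the square bounds the other two by
`w² / (2ν)`. -/
theorem integral_mul_thinFilmRHS_sub_le {ν : ℝ} (hν : 0 < ν) {u v : ℝ → ℝ}
    (hu : ContDiff ℝ 4 u) (hv : ContDiff ℝ 4 v)
    (hup : Function.Periodic u (2 * Real.pi)) (hvp : Function.Periodic v (2 * Real.pi)) :
    ∫ x in (-Real.pi)..Real.pi, 2 * (u x - v x) * (thinFilmRHS ν u x - thinFilmRHS ν v x) ≤
      1 / (2 * ν) * ∫ x in (-Real.pi)..Real.pi, (u x - v x) ^ 2 := by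
  have cu : ∀ j : ℕ, j ≤ 4 → Continuous (iteratedDeriv j u) := fun j hj =>
    hu.continuous_iteratedDeriv j (by exact_mod_cast hj)
  have cv : ∀ j : ℕ, j ≤ 4 → Continuous (iteratedDeriv j v) := fun j hj =>
    hv.continuous_iteratedDeriv j (by exact_mod_cast hj)
  have du : ∀ j : ℕ, j < 4 → ∀ x, HasDerivAt (iteratedDeriv j u) (iteratedDeriv (j + 1) u x) x :=
    fun j hj => hasDerivAt_iteratedDeriv_of_contDiff (n := 4) hu hj
  have dv : ∀ j : ℕ, j < 4 → ∀ x, HasDerivAt (iteratedDeriv j v) (iteratedDeriv (j + 1) v x) x :=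
    fun j hj => hasDerivAt_iteratedDeriv_of_contDiff (n := 4) hv hj
  have cu0 : Continuous u := hu.continuous
  have cv0 : Continuous v := hv.continuous
  have cu1 := cu 1 (by norm_num)
  have cu2 := cu 2 (by norm_num)
  have cu3 := cu 3 (by norm_num)
  have cu4 := cu 4 (by norm_num)
  have cv1 := cv 1 (by norm_num)
  have cv2 := cv 2 (by norm_num)
  have cv3 := cv 3 (by norm_num)
  have cv4 := cv 4 (by norm_num)
  -- `G` collects the boundary terms of all the integrations by parts. Its derivative `g` integrates
  -- to zero by periodicity, so subtracting `2 g` reduces the claim to a pointwise inequality.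
  set G : ℝ → ℝ := fun x => (u x - v x) * (iteratedDeriv 1 u x ^ 3 - iteratedDeriv 1 v x ^ 3)
    - ν * ((u x - v x) * (iteratedDeriv 3 u x - iteratedDeriv 3 v x)
      - (iteratedDeriv 1 u x - iteratedDeriv 1 v x)
        * (iteratedDeriv 2 u x - iteratedDeriv 2 v x)) with hG
  set g : ℝ → ℝ := fun x =>
    (iteratedDeriv 1 u x - iteratedDeriv 1 v x)
        * (iteratedDeriv 1 u x ^ 3 - iteratedDeriv 1 v x ^ 3)
      + (u x - v x) * (3 * iteratedDeriv 1 u x ^ 2 * iteratedDeriv 2 u x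
          - 3 * iteratedDeriv 1 v x ^ 2 * iteratedDeriv 2 v x)
      - ν * ((u x - v x) * (iteratedDeriv 4 u x - iteratedDeriv 4 v x)
        - (iteratedDeriv 2 u x - iteratedDeriv 2 v x) ^ 2) with hg
  have hGg : ∀ x, HasDerivAt G (g x) x := by
    intro x
    have u0 := du 0 (by norm_num) x
    have v0 := dv 0 (by norm_num) x
    rw [iteratedDeriv_zero] at u0 v0
    have u1 := du 1 (by norm_num) x
    have v1 := dv 1 (by norm_num) x
    have u2 := du 2 (by norm_num) x
    have v2 := dv 2 (by norm_num) x
    have u3 := du 3 (by norm_num) x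
    have v3 := dv 3 (by norm_num) x
    have := ((u0.sub v0).mul ((u1.pow 3).sub (v1.pow 3))).sub
      ((((u0.sub v0).mul (u3.sub v3)).sub ((u1.sub v1).mul (u2.sub v2))).const_mul ν)
    refine this.congr_deriv ?_
    simp only [hg, Pi.sub_apply, Pi.pow_apply, Nat.reduceAdd, Nat.reduceSub, Nat.cast_ofNat]
    ring
  have hgc : Continuous g := by
    simp only [hg]
    fun_prop
  have hg0 : ∫ x in (-Real.pi)..Real.pi, g x = 0 := by
    rw [intervalIntegral.integral_eq_sub_of_hasDerivAt (fun x _ => hGg x)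
      (hgc.intervalIntegrable _ _)]
    have e : ∀ f : ℝ → ℝ, Function.Periodic f (2 * Real.pi) → f Real.pi = f (-Real.pi) := by
      intro f hf
      rw [← hf (-Real.pi)]
      ring_nf
    have : G Real.pi = G (-Real.pi) := by
      simp only [hG, e u hup, e v hvp, e _ (hup.iteratedDeriv _), e _ (hvp.iteratedDeriv _)]
    rw [this, sub_self]
  simp only [thinFilmRHS_eq ν hu, thinFilmRHS_eq ν hv]
  have key : ∫ x in (-Real.pi)..Real.pi, (2 * (u x - v x) *
      (((3 * iteratedDeriv 1 u x ^ 2 - 1) * iteratedDeriv 2 u x - ν * iteratedDeriv 4 u x)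
      - ((3 * iteratedDeriv 1 v x ^ 2 - 1) * iteratedDeriv 2 v x - ν * iteratedDeriv 4 v x))
      - 2 * g x) ≤ ∫ x in (-Real.pi)..Real.pi, 1 / (2 * ν) * (u x - v x) ^ 2 := by
    apply intervalIntegral.integral_mono_on (by linarith [Real.pi_pos])
    · exact Continuous.intervalIntegrable (by fun_prop) _ _
    · exact Continuous.intervalIntegrable (by fun_prop) _ _
    · intro x _
      simp only [hg]
      generalize u x = a0
      generalize v x = b0
      generalize iteratedDeriv 1 u x = a1
      generalize iteratedDeriv 1 v x = b1
      generalize iteratedDeriv 2 u x = a2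
      generalize iteratedDeriv 2 v x = b2
      generalize iteratedDeriv 4 u x = a4
      generalize iteratedDeriv 4 v x = b4
      have h1 : 0 ≤ (a1 - b1) ^ 2 * ((a1 + b1) ^ 2 + a1 ^ 2 + b1 ^ 2) := by positivity
      have h2 : 0 ≤ 1 / (2 * ν) * ((a0 - b0) + 2 * ν * (a2 - b2)) ^ 2 := by positivity
      have h3 : 1 / (2 * ν) * ((a0 - b0) + 2 * ν * (a2 - b2)) ^ 2
        = 1 / (2 * ν) * (a0 - b0) ^ 2 + 2 * (a0 - b0) * (a2 - b2) + 2 * ν * (a2 - b2) ^ 2 := by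
        field_simp
        ring
      nlinarith
  rw [intervalIntegral.integral_sub (Continuous.intervalIntegrable (by fun_prop) _ _)
    (Continuous.intervalIntegrable (by fun_prop) _ _), intervalIntegral.integral_const_mul,
    intervalIntegral.integral_const_mul, hg0] at key
  linarith

theorem IsClassicalSolution.continuousOn_thinFilmRHS {ν T : ℝ} {h₀ : ℝ → ℝ} {h : ℝ → ℝ → ℝ}
    (H : IsClassicalSolution ν T h₀ h) :
    ContinuousOn (fun p : ℝ × ℝ => thinFilmRHS ν (h p.1) p.2) (Ico 0 T ×ˢ univ) := by
  have : ContinuousOn (fun p : ℝ × ℝ => (3 * iteratedDeriv 1 (h p.1) p.2 ^ 2 - 1) *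
      iteratedDeriv 2 (h p.1) p.2 - ν * iteratedDeriv 4 (h p.1) p.2) (Ico 0 T ×ˢ univ) := by
    have h1 := H.continuousOn 1 (by norm_num)
    have h2 := H.continuousOn 2 (by norm_num)
    have h4 := H.continuousOn 4 (by norm_num)
    fun_prop
  exact this.congr fun p hp => thinFilmRHS_eq ν (H.contDiff p.1 hp.1) p.2

theorem IsClassicalSolution.continuousOn_uncurry {ν T : ℝ} {h₀ : ℝ → ℝ} {h : ℝ → ℝ → ℝ}
    (H : IsClassicalSolution ν T h₀ h) :
    ContinuousOn (fun p : ℝ × ℝ => h p.1 p.2) (Ico 0 T ×ˢ univ) := by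
  simpa using H.continuousOn 0 (by norm_num)

/-- Classical solutions are determined by their initial datum. -/
theorem IsClassicalSolution.unique {ν T T' : ℝ} (hν : 0 < ν) {h₀ : ℝ → ℝ} {h h' : ℝ → ℝ → ℝ}
    (H : IsClassicalSolution ν T h₀ h) (H' : IsClassicalSolution ν T' h₀ h') {t : ℝ}
    (ht : 0 ≤ t) (htT : t < T) (htT' : t < T') : h t = h' t := by
  have hsub : Icc 0 t ⊆ Ico 0 T := fun s hs => ⟨hs.1, hs.2.trans_lt htT⟩
  have hsub' : Icc 0 t ⊆ Ico 0 T' := fun s hs => ⟨hs.1, hs.2.trans_lt htT'⟩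
  set w : ℝ → ℝ → ℝ := fun s x => h s x - h' s x with hw
  set r : ℝ → ℝ → ℝ := fun s x => thinFilmRHS ν (h s) x - thinFilmRHS ν (h' s) x with hr
  have wc : ContinuousOn (fun p : ℝ × ℝ => w p.1 p.2) (Icc 0 t ×ˢ univ) :=
    (H.continuousOn_uncurry.mono (prod_mono_left hsub)).sub
      (H'.continuousOn_uncurry.mono (prod_mono_left hsub'))
  have rc : ContinuousOn (fun p : ℝ × ℝ => r p.1 p.2) (Icc 0 t ×ˢ univ) :=
    (H.continuousOn_thinFilmRHS.mono (prod_mono_left hsub)).sub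
      (H'.continuousOn_thinFilmRHS.mono (prod_mono_left hsub'))
  have wslice : ∀ s ∈ Icc 0 t, Continuous (w s) := fun s hs =>
    (H.contDiff s (hsub hs)).continuous.sub (H'.contDiff s (hsub' hs)).continuous
  have rslice : ∀ s ∈ Icc 0 t, Continuous (r s) := fun s hs => by
    have := rc.comp_continuous (f := fun x : ℝ => (s, x)) (by fun_prop) (fun x => ⟨hs, mem_univ _⟩)
    exact this
  set E : ℝ → ℝ := fun s => ∫ x in (-Real.pi)..Real.pi, w s x ^ 2 with hE
  have Ec : ContinuousOn E (Icc 0 t) := by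
    -- Projecting time to `[0, t]` makes the integrand continuous on the whole plane without
    -- changing it on the interval.
    have hcl : Continuous fun p : ℝ × ℝ => w (projIcc 0 t ht p.1) p.2 ^ 2 := by
      have := wc.comp_continuous (f := fun p : ℝ × ℝ => ((projIcc 0 t ht p.1 : ℝ), p.2))
        (by fun_prop) (fun p => ⟨(projIcc 0 t ht p.1).2, mem_univ _⟩)
      exact this.pow 2
    have := intervalIntegral.continuous_parametric_intervalIntegral_of_continuous'
      (μ := volume) (f := fun s x => w (projIcc 0 t ht s) x ^ 2) hcl (-Real.pi) Real.pi
    refine this.continuousOn.congr fun s hs => ?_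
    simp only [hE, projIcc_of_mem ht hs]
  have hwt : ∀ s ∈ Ioo 0 t, ∀ x, HasDerivAt (fun s => w s x) (r s x) s := fun s hs x =>
    ((H.equation s (hsub (Ioo_subset_Icc_self hs)) x).hasDerivAt (Ici_mem_nhds hs.1)).sub
      ((H'.equation s (hsub' (Ioo_subset_Icc_self hs)) x).hasDerivAt (Ici_mem_nhds hs.1))
  obtain ⟨B, hB⟩ := (isCompact_Icc.prod isCompact_Icc : IsCompact
      (Icc 0 t ×ˢ Icc (-Real.pi) Real.pi)).exists_bound_of_continuousOn
    (f := fun p : ℝ × ℝ => 2 * w p.1 p.2 * r p.1 p.2)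
    (((wc.const_smul (2 : ℝ)).mul rc).mono (prod_mono_right (subset_univ _)))
  have hEd : ∀ s ∈ Ioo 0 t,
      HasDerivAt E (∫ x in (-Real.pi)..Real.pi, 2 * w s x * r s x) s := by
    intro s hs
    have hpi : uIoc (-Real.pi) Real.pi ⊆ Icc (-Real.pi) Real.pi := by
      rw [uIoc_of_le (by linarith [Real.pi_pos])]
      exact Ioc_subset_Icc_self
    refine (intervalIntegral.hasDerivAt_integral_of_dominated_loc_of_deriv_le
      (F := fun s x => w s x ^ 2) (F' := fun s x => 2 * w s x * r s x) (s := Ioo 0 t)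
      (bound := fun _ => B) (Ioo_mem_nhds hs.1 hs.2) ?_ ?_ ?_ ?_ ?_ ?_).2
    · filter_upwards [Ioo_mem_nhds hs.1 hs.2] with τ hτ
      exact ((wslice τ (Ioo_subset_Icc_self hτ)).pow 2).aestronglyMeasurable
    · exact ((wslice s (Ioo_subset_Icc_self hs)).pow 2).intervalIntegrable _ _
    · have h1 := wslice s (Ioo_subset_Icc_self hs)
      have h2 := rslice s (Ioo_subset_Icc_self hs)
      exact Continuous.aestronglyMeasurable (by fun_prop)
    · exact ae_of_all _ fun x hx τ hτ => hB (τ, x) ⟨Ioo_subset_Icc_self hτ, hpi hx⟩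
    · exact intervalIntegrable_const
    · refine ae_of_all _ fun x hx τ hτ => ?_
      refine ((hwt τ hτ x).pow 2).congr_deriv ?_
      norm_num
  set C : ℝ := 1 / (2 * ν) with hC
  -- Grönwall's argument, from `E' ≤ C E`.
  have hanti : AntitoneOn (fun s => Real.exp (-C * s) * E s) (Icc 0 t) := by
    have hd : ∀ s ∈ Ioo 0 t, HasDerivAt (fun s => Real.exp (-C * s) * E s)
        (Real.exp (-C * s) * (-C) * E s + Real.exp (-C * s) *
          ∫ x in (-Real.pi)..Real.pi, 2 * w s x * r s x) s := fun s hs => by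
      have h1 : HasDerivAt (fun s => -C * s) (-C) s := by
        simpa using (hasDerivAt_id s).const_mul (-C)
      exact h1.exp.mul (hEd s hs)
    apply antitoneOn_of_deriv_nonpos (convex_Icc 0 t)
    · exact ContinuousOn.mul (by fun_prop) Ec
    · rw [interior_Icc]
      exact fun s hs => (hd s hs).differentiableAt.differentiableWithinAt
    · rw [interior_Icc]
      intro s hs
      rw [(hd s hs).deriv]
      have hs' := Ioo_subset_Icc_self hs
      have := integral_mul_thinFilmRHS_sub_le hν (H.contDiff s (hsub hs'))
        (H'.contDiff s (hsub' hs')) (H.periodic s (hsub hs')) (H'.periodic s (hsub' hs'))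
      have hle : (∫ x in (-Real.pi)..Real.pi, 2 * w s x * r s x) ≤ C * E s := this
      have hp := Real.exp_pos (-C * s)
      nlinarith [mul_le_mul_of_nonneg_left hle hp.le]
  have hE0 : E 0 = 0 := by
    have : ∀ x, w 0 x = 0 := fun x => by simp [hw, H.initial, H'.initial]
    simp [hE, this]
  have hEt : E t ≤ 0 := by
    have := hanti (left_mem_Icc.2 ht) (right_mem_Icc.2 ht) ht
    simp only [hE0, mul_zero] at this
    exact nonpos_of_mul_nonpos_right this (Real.exp_pos _)
  have htt := right_mem_Icc.2 ht
  have hzero : ∀ x ∈ Icc (-Real.pi) Real.pi, w t x = 0 := by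
    by_contra! hne
    obtain ⟨x, hx, hne⟩ := hne
    have hpos : 0 < E t := by
      refine intervalIntegral.integral_pos (by linarith [Real.pi_pos])
        ((wslice t htt).pow 2).continuousOn (fun y _ => sq_nonneg _) ⟨x, hx, by positivity⟩
    linarith
  have hper : Function.Periodic (w t) (2 * Real.pi) := fun x => by
    simp only [hw, H.periodic t (hsub htt) x, H'.periodic t (hsub' htt) x]
  funext x
  obtain ⟨y, hy, hxy⟩ := hper.exists_mem_Ico (by positivity) x (-Real.pi)
  have : w t x = 0 := by
    rw [hxy]
    exact hzero y ⟨hy.1, by linarith [hy.2]⟩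
  exact sub_eq_zero.1 this

end Uniqueness

/-! ### The weighted `ℓ¹` algebra of cosine coefficients. -/

section WeightedCosineAlgebra

section
variable {ι X Y : Type*} [NormedAddCommGroup X]

theorem lp.hasSum_norm_one (b : ℓ¹(ι, X)) : HasSum (fun k => ‖b k‖) ‖b‖ := by
  simpa using lp.hasSum_norm (p := 1) (by simp) b

variable [NormedSpace ℝ X] [NormedAddCommGroup Y] [NormedSpace ℝ Y]

/-- The map on `ℓ¹` given by a uniformly bounded family of linear maps on the coordinates. -/
def lp.mapOne (L : ι → X →L[ℝ] Y) (C : ℝ) (hL : ∀ k v, ‖L k v‖ ≤ C * ‖v‖) :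
    ℓ¹(ι, X) →L[ℝ] ℓ¹(ι, Y) :=
  LinearMap.mkContinuous
    { toFun := fun b => ⟨fun k => L k (b k), memℓp_gen (by
        simpa using Summable.of_nonneg_of_le (fun _ => norm_nonneg _) (fun k => hL k (b k))
          ((lp.hasSum_norm_one b).summable.mul_left C))⟩
      map_add' := fun b b' => by
        ext1
        funext k
        exact map_add (L k) _ _
      map_smul' := fun r b => by
        ext1
        funext k
        exact map_smul (L k) _ _ }
    C (fun b => by
      have h := lp.hasSum_norm_one b
      refine (lp.hasSum_norm_one _).tsum_eq.symm.trans_le ?_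
      rw [← h.tsum_eq, ← tsum_mul_left]
      exact Summable.tsum_le_tsum (fun k => hL k (b k)) (lp.hasSum_norm_one _).summable
        (h.summable.mul_left C))

theorem lp.norm_mapOne_apply_le (L : ι → X →L[ℝ] Y) {C : ℝ} (hC : 0 ≤ C)
    (hL : ∀ k v, ‖L k v‖ ≤ C * ‖v‖) (b : ℓ¹(ι, X)) : ‖lp.mapOne L C hL b‖ ≤ C * ‖b‖ :=
  (ContinuousLinearMap.le_opNorm _ _).trans
    (mul_le_mul_of_nonneg_right (LinearMap.mkContinuous_norm_le _ hC _) (norm_nonneg _))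

end

/-- The weight of the frequency `k`. -/
def freqWeight (k : ℤ) : ℝ := (1 + |(k : ℝ)|) ^ 4

theorem freqWeight_pos (k : ℤ) : 0 < freqWeight k := by unfold freqWeight; positivity

theorem one_le_freqWeight (k : ℤ) : 1 ≤ freqWeight k :=
  one_le_pow₀ (by linarith [abs_nonneg (k : ℝ)])

/-- Since `1 + |k + l| ≤ (1 + |k|)(1 + |l|)`. This is what makes the weighted norm submultiplicative
for products of series. -/
theorem freqWeight_add_le (k l : ℤ) : freqWeight (k + l) ≤ freqWeight k * freqWeight l := by
  unfold freqWeight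
  rw [← mul_pow]
  push_cast
  gcongr
  nlinarith [abs_add_le (k : ℝ) l, mul_nonneg (abs_nonneg (k : ℝ)) (abs_nonneg (l : ℝ))]

theorem freqWeight_neg (k : ℤ) : freqWeight (-k) = freqWeight k := by simp [freqWeight]

theorem freqWeight_sub_le (k l : ℤ) : freqWeight (k - l) ≤ freqWeight k * freqWeight l := by
  rw [sub_eq_add_neg, ← freqWeight_neg l]
  exact freqWeight_add_le k (-l)

variable {X : Type*} [NormedCommRing X]

theorem summable_norm_mul_norm (b b' : ℓ¹(ℤ, X)) :
    Summable fun p : ℤ × ℤ => ‖b p.1‖ * ‖b' p.2‖ :=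
  (lp.hasSum_norm_one b).summable.mul_of_nonneg (lp.hasSum_norm_one b').summable
    (fun _ => norm_nonneg _) (fun _ => norm_nonneg _)

variable [NormedAlgebra ℝ X]

/-- The contribution of the frequencies `p.1` and `p.2` to the product of two cosine series, whose
coefficients are stored multiplied by `freqWeight`. -/
def cosMulTerm (b b' : ℓ¹(ℤ, X)) (p : ℤ × ℤ) : ℓ¹(ℤ, X) :=
  lp.single 1 (p.1 + p.2)
      ((freqWeight (p.1 + p.2) / (2 * (freqWeight p.1 * freqWeight p.2))) • (b p.1 * b' p.2))
    + lp.single 1 (p.1 - p.2)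
      ((freqWeight (p.1 - p.2) / (2 * (freqWeight p.1 * freqWeight p.2))) • (b p.1 * b' p.2))

/-- In `cos kx cos lx = (cos (k + l)x + cos (k - l)x) / 2` each summand carries a factor `1/2`, and
the ratio of weights is at most `1`. -/
theorem norm_cosMulTerm_le (b b' : ℓ¹(ℤ, X)) (p : ℤ × ℤ) :
    ‖cosMulTerm b b' p‖ ≤ ‖b p.1‖ * ‖b' p.2‖ := by
  have hw : 0 < freqWeight p.1 * freqWeight p.2 := mul_pos (freqWeight_pos _) (freqWeight_pos _)
  have half : ∀ j : ℤ, freqWeight j ≤ freqWeight p.1 * freqWeight p.2 →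
      ‖lp.single (E := fun _ : ℤ => X) 1 j
        ((freqWeight j / (2 * (freqWeight p.1 * freqWeight p.2))) • (b p.1 * b' p.2))‖
      ≤ 1 / 2 * (‖b p.1‖ * ‖b' p.2‖) := by
    intro j hj
    rw [lp.norm_single (by norm_num), norm_smul]
    refine mul_le_mul ?_ (norm_mul_le _ _) (norm_nonneg _) (by norm_num)
    rw [Real.norm_of_nonneg (div_nonneg (freqWeight_pos j).le (by positivity)),
      div_le_iff₀ (by positivity)]
    linarith
  refine (norm_add_le _ _).trans ?_
  linarith [half _ (freqWeight_add_le p.1 p.2), half _ (freqWeight_sub_le p.1 p.2)]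

theorem summable_norm_cosMulTerm (b b' : ℓ¹(ℤ, X)) :
    Summable fun p => ‖cosMulTerm b b' p‖ :=
  .of_nonneg_of_le (fun _ => norm_nonneg _) (norm_cosMulTerm_le b b') (summable_norm_mul_norm b b')

/-- The product of cosine series in terms of the weighted coefficients. -/
def cosMul (b b' : ℓ¹(ℤ, X)) : ℓ¹(ℤ, X) := ∑' p, cosMulTerm b b' p

theorem norm_cosMul_le (b b' : ℓ¹(ℤ, X)) : ‖cosMul b b'‖ ≤ ‖b‖ * ‖b'‖ := by
  refine (norm_tsum_le_tsum_norm (summable_norm_cosMulTerm b b')).trans ?_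
  refine (Summable.tsum_le_tsum (norm_cosMulTerm_le b b') (summable_norm_cosMulTerm b b')
    (summable_norm_mul_norm b b')).trans_eq ?_
  rw [← (lp.hasSum_norm_one b).tsum_eq, ← (lp.hasSum_norm_one b').tsum_eq]
  exact (tsum_mul_tsum_of_summable_norm (lp.hasSum_norm_one b).summable.norm
    (lp.hasSum_norm_one b').summable.norm).symm

variable [CompleteSpace X]

theorem summable_cosMulTerm (b b' : ℓ¹(ℤ, X)) : Summable (cosMulTerm b b') :=
  (summable_norm_cosMulTerm b b').of_norm

theorem cosMul_sub_left (b₁ b₂ b : ℓ¹(ℤ, X)) :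
    cosMul (b₁ - b₂) b = cosMul b₁ b - cosMul b₂ b := by
  rw [cosMul, cosMul, cosMul,
    ← (summable_cosMulTerm b₁ b).tsum_sub (summable_cosMulTerm b₂ b)]
  congr 1
  funext p
  simp only [cosMulTerm, lp.coeFn_sub, Pi.sub_apply, sub_mul, smul_sub, lp.single_sub]
  abel

theorem cosMul_sub_right (b b₁ b₂ : ℓ¹(ℤ, X)) :
    cosMul b (b₁ - b₂) = cosMul b b₁ - cosMul b b₂ := by
  rw [cosMul, cosMul, cosMul,
    ← (summable_cosMulTerm b b₁).tsum_sub (summable_cosMulTerm b b₂)]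
  congr 1
  funext p
  simp only [cosMulTerm, lp.coeFn_sub, Pi.sub_apply, mul_sub, smul_sub, lp.single_sub]
  abel

/-- The cube of a cosine series in terms of the weighted coefficients. -/
def cosCube (b : ℓ¹(ℤ, X)) : ℓ¹(ℤ, X) := cosMul (cosMul b b) b

/-- Telescoping: one factor is changed at a time, so commutativity of `cosMul` is not needed. -/
theorem norm_cosCube_sub_le {b b' : ℓ¹(ℤ, X)} {R : ℝ} (hb : ‖b‖ ≤ R) (hb' : ‖b'‖ ≤ R) :
    ‖cosCube b - cosCube b'‖ ≤ 3 * R ^ 2 * ‖b - b'‖ := by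
  have hR : 0 ≤ R := (norm_nonneg b).trans hb
  have e : cosCube b - cosCube b' = cosMul (cosMul (b - b') b) b + cosMul (cosMul b' (b - b')) b
      + cosMul (cosMul b' b') (b - b') := by
    simp only [cosCube, cosMul_sub_left, cosMul_sub_right]
    abel
  have h1 : ‖cosMul (cosMul (b - b') b) b‖ ≤ ‖b - b'‖ * R * R :=
    (norm_cosMul_le _ _).trans (mul_le_mul ((norm_cosMul_le _ _).trans (by gcongr)) hb
      (norm_nonneg _) (by positivity))
  have h2 : ‖cosMul (cosMul b' (b - b')) b‖ ≤ R * ‖b - b'‖ * R :=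
    (norm_cosMul_le _ _).trans (mul_le_mul ((norm_cosMul_le _ _).trans (by gcongr)) hb
      (norm_nonneg _) (by positivity))
  have h3 : ‖cosMul (cosMul b' b') (b - b')‖ ≤ R * R * ‖b - b'‖ :=
    (norm_cosMul_le _ _).trans (mul_le_mul_of_nonneg_right
      ((norm_cosMul_le _ _).trans (by gcongr)) (norm_nonneg _))
  rw [e]
  refine (norm_add₃_le).trans ?_
  linarith

theorem cosCube_zero : cosCube (0 : ℓ¹(ℤ, X)) = 0 := by
  have : cosMul (cosMul (0 : ℓ¹(ℤ, X)) 0) (0 - 0) = 0 := by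
    rw [cosMul_sub_right, sub_self]
  simpa [cosCube] using this

end WeightedCosineAlgebra

/-! ### Evaluating cosine series pointwise. -/

section Evaluation

variable {K : Type*} [TopologicalSpace K] [CompactSpace K]

/-- The value at `t` and `x` of the cosine series with weighted coefficients `b`. -/
def cosEval (t : K) (x : ℝ) : ℓ¹(ℤ, C(K, ℝ)) →L[ℝ] ℝ :=
  lp.tsumCLM ℝ ℤ ℝ ∘L lp.mapOne
    (fun k => (Real.cos (k * x) / freqWeight k) • ContinuousMap.evalCLM ℝ t) 1 (fun k v => by
      have h1 : |Real.cos (k * x) / freqWeight k| ≤ 1 := by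
        rw [abs_div, abs_of_pos (freqWeight_pos k), div_le_one (freqWeight_pos k)]
        exact (Real.abs_cos_le_one _).trans (one_le_freqWeight k)
      have h2 : |v t| ≤ ‖v‖ := v.norm_coe_le_norm t
      change ‖Real.cos (k * x) / freqWeight k * v t‖ ≤ 1 * ‖v‖
      rw [norm_mul, Real.norm_eq_abs, Real.norm_eq_abs]
      exact mul_le_mul h1 h2 (abs_nonneg _) zero_le_one)

theorem cosEval_apply (t : K) (x : ℝ) (b : ℓ¹(ℤ, C(K, ℝ))) :
    cosEval t x b = ∑' k : ℤ, b k t / freqWeight k * Real.cos (k * x) := by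
  change ∑' k : ℤ, Real.cos (k * x) / freqWeight k * b k t = _
  congr 1
  funext k
  ring

theorem cosEval_single (t : K) (x : ℝ) (k : ℤ) (v : C(K, ℝ)) :
    cosEval t x (lp.single 1 k v) = v t / freqWeight k * Real.cos (k * x) := by
  rw [cosEval_apply, tsum_eq_single k]
  · rw [lp.single_apply_self]
  · intro j hj
    rw [lp.single_apply_ne _ _ _ hj]
    simp

/-- Turns closeness of coefficients into closeness of slopes at a point, as the perturbation in `s`
requires. -/
theorem abs_cosEval_le (t : K) (x : ℝ) (b : ℓ¹(ℤ, C(K, ℝ))) : |cosEval t x b| ≤ ‖b‖ := by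
  refine (lp.norm_tsum_le (α := ℤ) (E := ℝ) (lp.mapOne _ 1 _ b)).trans ?_
  simpa using lp.norm_mapOne_apply_le _ zero_le_one _ b

theorem abs_coeff_le (t : K) (b : ℓ¹(ℤ, C(K, ℝ))) (k : ℤ) :
    |b k t / freqWeight k| ≤ ‖b k‖ / freqWeight k := by
  rw [abs_div, abs_of_pos (freqWeight_pos k)]
  exact div_le_div_of_nonneg_right ((b k).norm_coe_le_norm t) (freqWeight_pos k).le

theorem summable_norm_cosEval (t : K) (x : ℝ) (b : ℓ¹(ℤ, C(K, ℝ))) :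
    Summable fun k : ℤ => ‖b k t / freqWeight k * Real.cos (k * x)‖ := by
  refine .of_nonneg_of_le (fun _ => norm_nonneg _) (fun k => ?_) (lp.hasSum_norm_one b).summable
  rw [norm_mul, Real.norm_eq_abs, Real.norm_eq_abs]
  calc _ ≤ ‖b k‖ / freqWeight k * 1 :=
        mul_le_mul (abs_coeff_le t b k) (Real.abs_cos_le_one _) (abs_nonneg _)
          (div_nonneg (norm_nonneg _) (freqWeight_pos k).le)
    _ ≤ ‖b k‖ := by
        rw [mul_one]
        exact div_le_self (norm_nonneg _) (one_le_freqWeight k)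

/-- Evaluation is continuous and linear, so it passes through the defining sum; each term is then
the product-to-sum formula for cosines. -/
theorem cosEval_cosMul (t : K) (x : ℝ) (b b' : ℓ¹(ℤ, C(K, ℝ))) :
    cosEval t x (cosMul b b') = cosEval t x b * cosEval t x b' := by
  rw [cosMul, ContinuousLinearMap.map_tsum _ (summable_cosMulTerm b b'), cosEval_apply t x b,
    cosEval_apply t x b', tsum_mul_tsum_of_summable_norm (summable_norm_cosEval t x b)
      (summable_norm_cosEval t x b')]
  congr 1
  funext p
  rw [cosMulTerm, map_add, cosEval_single, cosEval_single]
  have h1 := (freqWeight_pos p.1).ne'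
  have h2 := (freqWeight_pos p.2).ne'
  have h3 := (freqWeight_pos (p.1 + p.2)).ne'
  have h4 := (freqWeight_pos (p.1 - p.2)).ne'
  have e1 : Real.cos (((p.1 + p.2 : ℤ) : ℝ) * x) = Real.cos (p.1 * x) * Real.cos (p.2 * x)
      - Real.sin (p.1 * x) * Real.sin (p.2 * x) := by
    rw [← Real.cos_add]
    push_cast
    ring_nf
  have e2 : Real.cos (((p.1 - p.2 : ℤ) : ℝ) * x) = Real.cos (p.1 * x) * Real.cos (p.2 * x)
      + Real.sin (p.1 * x) * Real.sin (p.2 * x) := by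
    rw [← Real.cos_sub]
    push_cast
    ring_nf
  rw [e1, e2]
  simp only [ContinuousMap.smul_apply, ContinuousMap.mul_apply, smul_eq_mul]
  field_simp
  ring

theorem cosEval_cosCube (t : K) (x : ℝ) (b : ℓ¹(ℤ, C(K, ℝ))) :
    cosEval t x (cosCube b) = cosEval t x b ^ 3 := by
  rw [cosCube, cosEval_cosMul, cosEval_cosMul]
  ring

end Evaluation

/-! ### The Duhamel formula and the fixed point. -/

section Duhamel

/-- The solution of `y' = -lam * y + f`, `y 0 = a`. -/
def relaxation (lam a : ℝ) (f : ℝ → ℝ) (t : ℝ) : ℝ :=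
  Real.exp (-lam * t) * (a + ∫ s in (0 : ℝ)..t, Real.exp (lam * s) * f s)

theorem hasDerivAt_relaxation (lam a : ℝ) {f : ℝ → ℝ} (hf : Continuous f) (t : ℝ) :
    HasDerivAt (relaxation lam a f) (-lam * relaxation lam a f t + f t) t := by
  have hc : Continuous fun s => Real.exp (lam * s) * f s := by fun_prop
  have h1 : HasDerivAt (fun t => -lam * t) (-lam) t := by
    simpa using (hasDerivAt_id t).const_mul (-lam)
  have h2 := (intervalIntegral.integral_hasDerivAt_right (hc.intervalIntegrable 0 t)
    (hc.stronglyMeasurableAtFilter _ _) hc.continuousAt).const_add a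
  refine (h1.exp.mul h2).congr_deriv ?_
  have e : Real.exp (-lam * t) * Real.exp (lam * t) = 1 := by
    rw [← Real.exp_add]
    simp
  unfold relaxation
  linear_combination f t * e

theorem continuous_relaxation (lam a : ℝ) {f : ℝ → ℝ} (hf : Continuous f) :
    Continuous (relaxation lam a f) :=
  continuous_iff_continuousAt.2 fun t => (hasDerivAt_relaxation lam a hf t).continuousAt

theorem relaxation_zero_right (lam a : ℝ) (f : ℝ → ℝ) : relaxation lam a f 0 = a := by
  simp [relaxation]

theorem relaxation_eq_integral (lam a : ℝ) {f : ℝ → ℝ} (hf : Continuous f) (t : ℝ) :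
    relaxation lam a f t = a + ∫ s in (0 : ℝ)..t, (-lam * relaxation lam a f s + f s) := by
  have hc := continuous_relaxation lam a hf
  rw [intervalIntegral.integral_eq_sub_of_hasDerivAt
    (fun s _ => hasDerivAt_relaxation lam a hf s)
    (Continuous.intervalIntegrable (by fun_prop) _ _), relaxation_zero_right]
  ring

theorem relaxation_add (lam : ℝ) {f g : ℝ → ℝ} (hf : Continuous f) (hg : Continuous g) (t : ℝ) :
    relaxation lam 0 (fun s => f s + g s) t = relaxation lam 0 f t + relaxation lam 0 g t := by
  simp only [relaxation, mul_add]
  rw [intervalIntegral.integral_add (Continuous.intervalIntegrable (by fun_prop) _ _)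
    (Continuous.intervalIntegrable (by fun_prop) _ _)]
  ring

theorem relaxation_const_mul (lam : ℝ) (f : ℝ → ℝ) (r t : ℝ) :
    relaxation lam 0 (fun s => r * f s) t = r * relaxation lam 0 f t := by
  simp only [relaxation, mul_left_comm _ r, intervalIntegral.integral_const_mul, zero_add]

/-- The relaxation kernel with rate `ν k⁴` gains a square root of time against `k²`. -/
theorem abs_sq_mul_relaxation_le {ν T : ℝ} (hν : 0 < ν) {f : ℝ → ℝ} {M : ℝ} (hM : ∀ t, |f t| ≤ M) (k : ℝ) {t : ℝ} (ht : 0 ≤ t) (htT : t ≤ T) :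
    |k ^ 2 * relaxation (ν * k ^ 4) 0 f t| ≤ √(T / ν) * M := by
  have hM0 : 0 ≤ M := (abs_nonneg _).trans (hM 0)
  set lam := ν * k ^ 4 with hlam
  have hlam0 : 0 ≤ lam := by positivity
  set I := relaxation lam 0 (fun _ => 1) t with hI
  have hfI : |relaxation lam 0 f t| ≤ I * M := by
    have h : ‖∫ s in (0 : ℝ)..t, Real.exp (lam * s) * f s‖
        ≤ ∫ s in (0 : ℝ)..t, Real.exp (lam * s) * M := by
      refine intervalIntegral.norm_integral_le_of_norm_le ht (ae_of_all _ fun s _ => ?_)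
        (Continuous.intervalIntegrable (by fun_prop) _ _)
      rw [norm_mul, Real.norm_of_nonneg (Real.exp_pos _).le]
      exact mul_le_mul_of_nonneg_left (hM s) (Real.exp_pos _).le
    rw [intervalIntegral.integral_mul_const, Real.norm_eq_abs] at h
    simp only [relaxation, zero_add, hI, abs_mul, abs_of_pos (Real.exp_pos _), mul_one, mul_assoc]
    exact mul_le_mul_of_nonneg_left h (Real.exp_pos _).le
  have hI0 : 0 ≤ I := by
    simp only [hI, relaxation, zero_add]
    exact mul_nonneg (Real.exp_pos _).le
      (intervalIntegral.integral_nonneg ht fun s _ => by positivity)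
  have hIt : I ≤ T := by
    refine le_trans ?_ htT
    have h1 : ∫ s in (0 : ℝ)..t, Real.exp (lam * s) * 1 ≤ ∫ s in (0 : ℝ)..t, Real.exp (lam * t) := by
      refine intervalIntegral.integral_mono_on ht
        (Continuous.intervalIntegrable (by fun_prop) _ _) intervalIntegrable_const fun s hs => ?_
      rw [mul_one]
      exact Real.exp_le_exp.2 (mul_le_mul_of_nonneg_left hs.2 hlam0)
    rw [intervalIntegral.integral_const, sub_zero, smul_eq_mul] at h1
    simp only [hI, relaxation, zero_add]
    refine (mul_le_mul_of_nonneg_left h1 (Real.exp_pos _).le).trans_eq ?_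
    rw [mul_left_comm, ← Real.exp_add]
    simp
  have hlI : lam * I ≤ 1 := by
    have h1 : ∫ s in (0 : ℝ)..t, lam * Real.exp (lam * s) = Real.exp (lam * t) - 1 := by
      rw [intervalIntegral.integral_eq_sub_of_hasDerivAt (f := fun s => Real.exp (lam * s))
        (fun s _ => ?_) (Continuous.intervalIntegrable (by fun_prop) _ _)]
      · simp
      · have h2 : HasDerivAt (fun t => lam * t) lam s := by
          simpa using (hasDerivAt_id s).const_mul lam
        simpa [mul_comm] using h2.exp
    rw [intervalIntegral.integral_const_mul] at h1
    simp only [hI, relaxation, zero_add, mul_one]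
    rw [mul_left_comm, h1, mul_sub, ← Real.exp_add]
    simp [Real.exp_nonneg]
  -- Interpolation between the two bounds on `I`: `ν (k² I)² = (lam I) I ≤ 1 · T`.
  have hkI : k ^ 2 * I ≤ √(T / ν) := by
    apply Real.le_sqrt_of_sq_le
    rw [le_div_iff₀ hν]
    have : (k ^ 2 * I) ^ 2 * ν = (lam * I) * I := by rw [hlam]; ring
    rw [this]
    nlinarith
  rw [abs_mul, abs_of_nonneg (sq_nonneg k)]
  calc k ^ 2 * |relaxation lam 0 f t| ≤ k ^ 2 * (I * M) := by gcongr
    _ = k ^ 2 * I * M := by ring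
    _ ≤ _ := by gcongr

variable {T : ℝ}

theorem abs_IccExtend_le (hT : 0 ≤ T) (f : C(Icc (0 : ℝ) T, ℝ)) (t : ℝ) :
    |IccExtend hT f t| ≤ ‖f‖ := f.norm_coe_le_norm _

theorem continuous_IccExtend (hT : 0 ≤ T) (f : C(Icc (0 : ℝ) T, ℝ)) :
    Continuous (IccExtend hT f) := f.continuous.Icc_extend'

/-- The Duhamel operator of the frequency `k`. -/
def duhamelMode {ν : ℝ} (hν : 0 < ν) (hT : 0 ≤ T) (k : ℤ) :
    C(Icc (0 : ℝ) T, ℝ) →L[ℝ] C(Icc (0 : ℝ) T, ℝ) :=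
  LinearMap.mkContinuous
    { toFun := fun f => ⟨fun t => (k : ℝ) ^ 2 * relaxation (ν * (k : ℝ) ^ 4) 0 (IccExtend hT f) t,
        ((continuous_relaxation _ _ (continuous_IccExtend hT f)).comp
          continuous_subtype_val).const_mul _⟩
      map_add' := fun f g => by
        ext t
        exact (congrArg _ (relaxation_add _ (continuous_IccExtend hT f)
          (continuous_IccExtend hT g) t)).trans (mul_add _ _ _)
      map_smul' := fun r f => by
        ext t
        exact (congrArg _ (relaxation_const_mul _ (IccExtend hT f) r t)).trans
          (mul_left_comm _ _ _) }
    √(T / ν) (fun f => (ContinuousMap.norm_le _ (by positivity)).2 fun t =>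
      abs_sq_mul_relaxation_le hν (abs_IccExtend_le hT f) k t.2.1 t.2.2)

theorem duhamelMode_apply {ν : ℝ} (hν : 0 < ν) (hT : 0 ≤ T) (k : ℤ) (f : C(Icc (0 : ℝ) T, ℝ))
    (t : Icc (0 : ℝ) T) : duhamelMode hν hT k f t =
      (k : ℝ) ^ 2 * relaxation (ν * (k : ℝ) ^ 4) 0 (IccExtend hT f) t := rfl

theorem norm_duhamelMode_apply_le {ν : ℝ} (hν : 0 < ν) (hT : 0 ≤ T) (k : ℤ)
    (f : C(Icc (0 : ℝ) T, ℝ)) : ‖duhamelMode hν hT k f‖ ≤ √(T / ν) * ‖f‖ :=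
  (ContinuousMap.norm_le _ (by positivity)).2 fun t =>
    abs_sq_mul_relaxation_le hν (abs_IccExtend_le hT f) k t.2.1 t.2.2

/-- The evolution of the frequency `k` under `u_t = -ν u_xxxx`. -/
def freeMode (ν T : ℝ) (k : ℤ) : ℝ →L[ℝ] C(Icc (0 : ℝ) T, ℝ) :=
  ContinuousLinearMap.toSpanSingleton ℝ
    ⟨fun t => Real.exp (-(ν * (k : ℝ) ^ 4) * t), by fun_prop⟩

theorem freeMode_apply (ν : ℝ) (k : ℤ) (a : ℝ) (t : Icc (0 : ℝ) T) :
    freeMode ν T k a t = a * Real.exp (-(ν * (k : ℝ) ^ 4) * t) := rfl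

theorem norm_freeMode_apply_le {ν : ℝ} (hν : 0 < ν) (k : ℤ) (a : ℝ) :
    ‖freeMode ν T k a‖ ≤ 1 * ‖a‖ := by
  refine (ContinuousMap.norm_le _ (by positivity)).2 fun t => ?_
  rw [freeMode_apply, norm_mul, Real.norm_of_nonneg (Real.exp_pos _).le, mul_comm]
  refine mul_le_mul_of_nonneg_right (Real.exp_le_one_iff.2 ?_) (norm_nonneg _)
  have := mul_nonneg (mul_nonneg hν.le (by positivity : 0 ≤ (k : ℝ) ^ 4)) t.2.1
  linarith

/-- The mild formulation of `u_t = (u³ - u)_xx - ν u_xxxx` for cosine series. -/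
def IsMildSolution {ν : ℝ} (hν : 0 < ν) (hT : 0 ≤ T) (a : ℓ¹(ℤ, ℝ))
    (b : ℓ¹(ℤ, C(Icc (0 : ℝ) T, ℝ))) : Prop :=
  b = lp.mapOne (freeMode ν T) 1 (norm_freeMode_apply_le hν) a
    + lp.mapOne (duhamelMode hν hT) √(T / ν) (norm_duhamelMode_apply_le hν hT) (b - cosCube b)

/-- The Duhamel operator has norm at most `√(T / ν)` even with its factor `k²`, so for small `T` the
nonlinear map contracts a ball. `T` depends only on `ν` and `M`, so all data of norm at most `M`
share one interval. The nonlinearity enters as `b - cosCube b` because `∂_x²` acts as `-k²`. -/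
theorem exists_isMildSolution {ν : ℝ} (hν : 0 < ν) (M : ℝ) :
    ∃ (T : ℝ) (hT : 0 < T) (sol : ℓ¹(ℤ, ℝ) → ℓ¹(ℤ, C(Icc (0 : ℝ) T, ℝ))),
      ∀ a, ‖a‖ ≤ M → IsMildSolution hν hT.le a (sol a) ∧
        ∀ a', ‖a'‖ ≤ M → ‖sol a - sol a'‖ ≤ 2 * ‖a - a'‖ := by
  rcases lt_or_ge M 0 with hM | hM
  · exact ⟨1, one_pos, fun _ => 0, fun a ha => absurd (norm_nonneg a) (by linarith)⟩
  set R := 2 * M with hR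
  have hR0 : 0 ≤ R := by positivity
  -- `1 + 3 R²` is the Lipschitz constant of `b - cosCube b` on the ball of radius `R`. With `T = ν
  -- δ²` the Duhamel operator has norm at most `δ`, which gives the contraction factor `1/2`; the
  -- radius `R = 2M` then makes the ball invariant.
  set δ := 1 / (2 * (1 + 3 * R ^ 2)) with hδ
  have hδ0 : 0 < δ := by positivity
  have hδR : δ * (1 + 3 * R ^ 2) = 1 / 2 := by
    rw [hδ]
    field_simp
  have hT : 0 < ν * δ ^ 2 := by positivity
  have hsqrt : √(ν * δ ^ 2 / ν) = δ := by
    rw [mul_div_cancel_left₀ _ hν.ne', Real.sqrt_sq hδ0.le]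
  set S := lp.mapOne (freeMode ν (ν * δ ^ 2)) 1 (norm_freeMode_apply_le hν) with hS
  set D := lp.mapOne (duhamelMode hν hT.le) √(ν * δ ^ 2 / ν) (norm_duhamelMode_apply_le hν hT.le)
    with hD
  have hSn : ∀ a, ‖S a‖ ≤ ‖a‖ := fun a => by
    simpa using lp.norm_mapOne_apply_le _ zero_le_one (norm_freeMode_apply_le hν) a
  have hDn : ∀ b, ‖D b‖ ≤ δ * ‖b‖ := fun b => by
    have := lp.norm_mapOne_apply_le _ (Real.sqrt_nonneg _) (norm_duhamelMode_apply_le hν hT.le) b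
    exact this.trans_eq (by rw [hsqrt])
  have hLip : ∀ b b', ‖b‖ ≤ R → ‖b'‖ ≤ R →
      ‖D (b - cosCube b) - D (b' - cosCube b')‖ ≤ 1 / 2 * ‖b - b'‖ := by
    intro b b' hb hb'
    rw [← map_sub, show b - cosCube b - (b' - cosCube b') = (b - b') - (cosCube b - cosCube b')
      by abel, ← hδR]
    refine (hDn _).trans ?_
    rw [mul_assoc]
    refine mul_le_mul_of_nonneg_left ((norm_sub_le _ _).trans ?_) hδ0.le
    linarith [norm_cosCube_sub_le hb hb']
  have hex : ∀ a, ‖a‖ ≤ M → ∃ b, ‖b‖ ≤ R ∧ b = S a + D (b - cosCube b) := by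
    intro a ha
    set Φ := fun b => S a + D (b - cosCube b) with hΦ
    set s := Metric.closedBall (0 : ℓ¹(ℤ, C(Icc (0 : ℝ) (ν * δ ^ 2), ℝ))) R with hs
    have hmaps : MapsTo Φ s s := by
      intro b hb
      rw [hs, mem_closedBall_zero_iff] at hb ⊢
      have h0 := hLip b 0 hb (by simpa using hR0)
      rw [cosCube_zero, sub_zero, map_zero, sub_zero, sub_zero] at h0
      have := norm_add_le (S a) (D (b - cosCube b))
      have := hSn a
      simp only [hΦ]
      linarith
    have hcontr : ContractingWith (1 / 2) (hmaps.restrict Φ s s) := by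
      refine ⟨by norm_num, LipschitzWith.of_dist_le_mul fun b b' => ?_⟩
      have hb := mem_closedBall_zero_iff.1 b.2
      have hb' := mem_closedBall_zero_iff.1 b'.2
      have := hLip b b' hb hb'
      rw [Subtype.dist_eq, Subtype.dist_eq, dist_eq_norm, dist_eq_norm]
      simpa [hΦ] using this
    obtain ⟨b, hbs, hb, -⟩ := hcontr.exists_fixedPoint'
      (x := 0) Metric.isClosed_closedBall.isComplete hmaps (by simpa [hs] using hR0) (edist_ne_top _ _)
    exact ⟨b, mem_closedBall_zero_iff.1 hbs, hb.symm⟩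
  choose! sol hsolR hsol using hex
  refine ⟨ν * δ ^ 2, hT, sol, fun a ha => ⟨hsol a ha, fun a' ha' => ?_⟩⟩
  -- Subtracting the fixed-point equations gives `‖d‖ ≤ ‖a - a'‖ + ‖d‖ / 2` for the difference `d`,
  -- hence the constant `2`.
  have e : sol a - sol a' = S (a - a')
      + (D (sol a - cosCube (sol a)) - D (sol a' - cosCube (sol a'))) := by
    rw [map_sub]
    nth_rw 1 [hsol a ha, hsol a' ha']
    abel
  have h1 := norm_add_le (S (a - a')) (D (sol a - cosCube (sol a)) - D (sol a' - cosCube (sol a')))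
  rw [← e] at h1
  linarith [hSn (a - a'), hLip _ _ (hsolR a ha) (hsolR a' ha')]

end Duhamel

/-! ### Termwise differentiation of trigonometric series. -/

section TrigonometricSeries

/-- The series `∑ d k sin (k x + θ)`. -/
def trigSeries (d : ℤ → ℝ) (θ x : ℝ) : ℝ := ∑' k : ℤ, d k * Real.sin (k * x + θ)

theorem norm_mul_sin_le (d y : ℝ) : ‖d * Real.sin y‖ ≤ |d| := by
  rw [norm_mul, Real.norm_eq_abs, Real.norm_eq_abs]
  exact mul_le_of_le_one_right (abs_nonneg _) (Real.abs_sin_le_one _)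

theorem summable_trigSeries {d : ℤ → ℝ} (hd : Summable fun k => |d k|) (θ x : ℝ) :
    Summable fun k : ℤ => d k * Real.sin (k * x + θ) :=
  .of_norm_bounded hd fun _ => norm_mul_sin_le _ _

/-- Differentiation multiplies the coefficients by `k` and advances the phase by `π / 2`. The phase
parameter keeps sines, cosines and all their derivatives in one family. -/
theorem hasDerivAt_trigSeries {d : ℤ → ℝ} (hd : Summable fun k => |d k|)
    (hd' : Summable fun k : ℤ => |(k : ℝ) * d k|) (θ x : ℝ) :
    HasDerivAt (trigSeries d θ) (trigSeries (fun k => k * d k) (θ + Real.pi / 2) x) x := by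
  refine hasDerivAt_tsum (𝕜 := ℝ) (u := fun k : ℤ => |(k : ℝ) * d k|)
    (g := fun k x => d k * Real.sin (k * x + θ))
    (g' := fun k x => k * d k * Real.sin (k * x + (θ + Real.pi / 2))) hd' (fun k y => ?_)
    (fun k y => norm_mul_sin_le _ _) (summable_trigSeries hd θ 0) x
  have h1 : HasDerivAt (fun y : ℝ => (k : ℝ) * y + θ) k y := by
    simpa using ((hasDerivAt_id y).const_mul (k : ℝ)).add_const θ
  refine (h1.sin.const_mul (d k)).congr_deriv ?_
  rw [← add_assoc, Real.sin_add_pi_div_two]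
  ring

theorem continuous_trigSeries {d : ℤ → ℝ → ℝ} (hdc : ∀ k, Continuous (d k)) {u : ℤ → ℝ}
    (hu : Summable u) (hd : ∀ k t, |d k t| ≤ u k) (θ : ℝ) :
    Continuous fun p : ℝ × ℝ => trigSeries (fun k => d k p.1) θ p.2 :=
  continuous_tsum (fun k => by have := hdc k; fun_prop) hu
    fun k p => (norm_mul_sin_le _ _).trans (hd k p.1)

theorem periodic_trigSeries (d : ℤ → ℝ) (θ : ℝ) :
    Function.Periodic (trigSeries d θ) (2 * Real.pi) := by
  intro x
  unfold trigSeries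
  congr 1
  funext k
  rw [show (k : ℝ) * (x + 2 * Real.pi) + θ = k * x + θ + k * (2 * Real.pi) by ring,
    Real.sin_add_int_mul_two_pi]

theorem iteratedDeriv_trigSeries {d : ℤ → ℝ} {n : ℕ}
    (hd : ∀ j ≤ n, Summable fun k : ℤ => |(k : ℝ) ^ j * d k|) {j : ℕ} (hj : j ≤ n) :
    iteratedDeriv j (trigSeries d 0)
      = trigSeries (fun k => (k : ℝ) ^ j * d k) (j * (Real.pi / 2)) := by
  induction j with
  | zero => simp
  | succ j ih =>
    rw [iteratedDeriv_succ, ih (by omega)]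
    funext x
    have h := hasDerivAt_trigSeries (hd j (by omega))
      ((hd (j + 1) hj).congr fun k => by ring_nf) (j * (Real.pi / 2)) x
    rw [h.deriv]
    congr 1
    · funext k
      ring
    · push_cast
      ring

theorem contDiff_trigSeries {d : ℤ → ℝ} {n : ℕ}
    (hd : ∀ j ≤ n, Summable fun k : ℤ => |(k : ℝ) ^ j * d k|) :
    ContDiff ℝ n (trigSeries d 0) := by
  rw [contDiff_nat_iff_iteratedDeriv]
  refine ⟨fun j hj => ?_, fun j hj => ?_⟩
  · rw [iteratedDeriv_trigSeries hd hj]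
    have h := continuous_trigSeries (d := fun k _ => (k : ℝ) ^ j * d k) (fun k => continuous_const)
      (hd j hj) (fun k t => le_rfl) (j * (Real.pi / 2))
    exact h.comp (g := fun p : ℝ × ℝ => trigSeries (fun k => (k : ℝ) ^ j * d k) _ p.2)
      (f := fun x : ℝ => ((0 : ℝ), x)) (by fun_prop)
  · rw [iteratedDeriv_trigSeries hd hj.le]
    exact fun x => (hasDerivAt_trigSeries (hd j hj.le)
      ((hd (j + 1) hj).congr fun k => by ring_nf) _ x).differentiableAt

/-- The integral representation extends each `C k` differentiably past `[0, T]`, so the two-sided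
theorem on termwise differentiation applies and its conclusion is restricted to the interval,
endpoints included. -/
theorem hasDerivWithinAt_tsum_of_eq_integral {ι : Type*} {T : ℝ} {C r : ι → ℝ → ℝ}
    (hr : ∀ k, Continuous (r k)) {u : ι → ℝ} (hu : Summable u) (hru : ∀ k t, |r k t| ≤ u k)
    {C₀ : ι → ℝ} (hC₀ : Summable C₀)
    (hC : ∀ k, ∀ t ∈ Icc 0 T, C k t = C₀ k + ∫ s in (0 : ℝ)..t, r k s) {t : ℝ}
    (ht : t ∈ Icc 0 T) :
    HasDerivWithinAt (fun t => ∑' k, C k t) (∑' k, r k t) (Icc 0 T) t := by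
  have h := hasDerivAt_tsum (𝕜 := ℝ) (g := fun k t => C₀ k + ∫ s in (0 : ℝ)..t, r k s) (g' := r)
    (y₀ := 0) hu (fun k y => (intervalIntegral.integral_hasDerivAt_right
      ((hr k).intervalIntegrable 0 y) ((hr k).stronglyMeasurableAtFilter _ _)
      (hr k).continuousAt).const_add _) hru (by simpa using hC₀) t
  exact h.hasDerivWithinAt.congr (fun s hs => tsum_congr fun k => hC k s hs)
    (tsum_congr fun k => hC k t ht)

end TrigonometricSeries

/-! ### Mild solutions are classical. -/

section Regularity

variable {T : ℝ}

/-- The coefficient of `cos (k x)` at time `t`, frozen outside `[0, T]`. -/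
def modeCoeff (hT : 0 ≤ T) (b : ℓ¹(ℤ, C(Icc (0 : ℝ) T, ℝ))) (k : ℤ) (t : ℝ) : ℝ :=
  IccExtend hT (b k) t / freqWeight k

theorem continuous_modeCoeff (hT : 0 ≤ T) (b : ℓ¹(ℤ, C(Icc (0 : ℝ) T, ℝ))) (k : ℤ) :
    Continuous (modeCoeff hT b k) := (continuous_IccExtend hT (b k)).div_const _

theorem freqWeight_mul_abs_modeCoeff_le (hT : 0 ≤ T) (b : ℓ¹(ℤ, C(Icc (0 : ℝ) T, ℝ))) (k : ℤ)
    (t : ℝ) : freqWeight k * |modeCoeff hT b k t| ≤ ‖b k‖ := by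
  rw [modeCoeff, abs_div, abs_of_pos (freqWeight_pos k), mul_div_cancel₀ _ (freqWeight_pos k).ne']
  exact abs_IccExtend_le hT (b k) t

theorem abs_pow_le_freqWeight (k : ℤ) {j : ℕ} (hj : j ≤ 4) : |(k : ℝ) ^ j| ≤ freqWeight k := by
  have h := abs_nonneg (k : ℝ)
  rw [abs_pow]
  calc |(k : ℝ)| ^ j ≤ (1 + |(k : ℝ)|) ^ j := by gcongr; linarith
    _ ≤ _ := pow_le_pow_right₀ (by linarith) hj

theorem abs_pow_mul_modeCoeff_le (hT : 0 ≤ T) (b : ℓ¹(ℤ, C(Icc (0 : ℝ) T, ℝ))) (k : ℤ)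
    (t : ℝ) {j : ℕ} (hj : j ≤ 4) : |(k : ℝ) ^ j * modeCoeff hT b k t| ≤ ‖b k‖ := by
  rw [abs_mul]
  exact (mul_le_mul_of_nonneg_right (abs_pow_le_freqWeight k hj) (abs_nonneg _)).trans
    (freqWeight_mul_abs_modeCoeff_le hT b k t)

theorem abs_div_intCast_le (y : ℝ) (k : ℤ) : |y / k| ≤ |y| := by
  rcases eq_or_ne k 0 with rfl | hk
  · simp
  · rw [abs_div]
    refine div_le_self (abs_nonneg _) ?_
    exact_mod_cast Int.one_le_abs hk

theorem abs_pow_mul_modeCoeff_div_le (hT : 0 ≤ T) (b : ℓ¹(ℤ, C(Icc (0 : ℝ) T, ℝ))) (k : ℤ)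
    (t : ℝ) {j : ℕ} (hj : j ≤ 4) : |(k : ℝ) ^ j * (modeCoeff hT b k t / k)| ≤ ‖b k‖ := by
  rw [← mul_div_assoc]
  exact (abs_div_intCast_le _ k).trans (abs_pow_mul_modeCoeff_le hT b k t hj)

theorem summable_pow_mul_modeCoeff (hT : 0 ≤ T) (b : ℓ¹(ℤ, C(Icc (0 : ℝ) T, ℝ)))
    (t : ℝ) {j : ℕ} (hj : j ≤ 4) : Summable fun k : ℤ => |(k : ℝ) ^ j * modeCoeff hT b k t| :=
  .of_nonneg_of_le (fun _ => abs_nonneg _) (fun k => abs_pow_mul_modeCoeff_le hT b k t hj)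
    (lp.hasSum_norm_one b).summable

theorem summable_pow_mul_modeCoeff_div (hT : 0 ≤ T) (b : ℓ¹(ℤ, C(Icc (0 : ℝ) T, ℝ)))
    (t : ℝ) {j : ℕ} (hj : j ≤ 4) :
    Summable fun k : ℤ => |(k : ℝ) ^ j * (modeCoeff hT b k t / k)| :=
  .of_nonneg_of_le (fun _ => abs_nonneg _) (fun k => abs_pow_mul_modeCoeff_div_le hT b k t hj)
    (lp.hasSum_norm_one b).summable

theorem cosEval_eq_trigSeries (hT : 0 ≤ T) (b : ℓ¹(ℤ, C(Icc (0 : ℝ) T, ℝ))) {t : ℝ}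
    (ht : t ∈ Icc 0 T) (x : ℝ) :
    cosEval ⟨t, ht⟩ x b = trigSeries (fun k => modeCoeff hT b k t) (Real.pi / 2) x := by
  rw [cosEval_apply, trigSeries]
  congr 1
  funext k
  rw [Real.sin_add_pi_div_two, modeCoeff, IccExtend_of_mem hT _ ht]

/-- The time derivative of the coefficient of `cos (k x)`. -/
def modeRate (ν : ℝ) (hT : 0 ≤ T) (b : ℓ¹(ℤ, C(Icc (0 : ℝ) T, ℝ))) (k : ℤ) (t : ℝ) : ℝ :=
  -ν * ((k : ℝ) ^ 4 * modeCoeff hT b k t) + (k : ℝ) ^ 2 * modeCoeff hT b k t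
    - (k : ℝ) ^ 2 * modeCoeff hT (cosCube b) k t

theorem continuous_modeRate (ν : ℝ) (hT : 0 ≤ T) (b : ℓ¹(ℤ, C(Icc (0 : ℝ) T, ℝ))) (k : ℤ) :
    Continuous (modeRate ν hT b k) := by
  have h1 := continuous_modeCoeff hT b k
  have h2 := continuous_modeCoeff hT (cosCube b) k
  unfold modeRate
  fun_prop

theorem abs_modeRate_le {ν : ℝ} (hν : 0 < ν) (hT : 0 ≤ T) (b : ℓ¹(ℤ, C(Icc (0 : ℝ) T, ℝ)))
    (k : ℤ) (t : ℝ) : |modeRate ν hT b k t| ≤ (ν + 1) * ‖b k‖ + ‖cosCube b k‖ := by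
  have h1 := abs_pow_mul_modeCoeff_le hT b k t (j := 4) le_rfl
  have h2 := abs_pow_mul_modeCoeff_le hT b k t (j := 2) (by norm_num)
  have h3 := abs_pow_mul_modeCoeff_le hT (cosCube b) k t (j := 2) (by norm_num)
  unfold modeRate
  refine (abs_sub _ _).trans ?_
  have h4 := abs_add_le (-ν * ((k : ℝ) ^ 4 * modeCoeff hT b k t))
    ((k : ℝ) ^ 2 * modeCoeff hT b k t)
  rw [abs_mul (-ν), abs_neg, abs_of_pos hν] at h4
  nlinarith

theorem summable_modeRate_bound (ν : ℝ) (b : ℓ¹(ℤ, C(Icc (0 : ℝ) T, ℝ))) :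
    Summable fun k => (ν + 1) * ‖b k‖ + ‖cosCube b k‖ :=
  ((lp.hasSum_norm_one b).summable.mul_left _).add (lp.hasSum_norm_one (cosCube b)).summable

variable {ν : ℝ} {hν : 0 < ν} {hT : 0 ≤ T} {a : ℓ¹(ℤ, ℝ)} {b : ℓ¹(ℤ, C(Icc (0 : ℝ) T, ℝ))}

/-- The fixed-point equation read at one frequency: each coefficient solves a scalar linear ODE with
forcing. -/
theorem IsMildSolution.apply_eq_relaxation (H : IsMildSolution hν hT a b) (k : ℤ) {t : ℝ}
    (ht : t ∈ Icc 0 T) : IccExtend hT (b k) t = relaxation (ν * (k : ℝ) ^ 4) (a k)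
      (fun s => (k : ℝ) ^ 2 * IccExtend hT (b k - cosCube b k) s) t := by
  have h : b k = freeMode ν T k (a k) + duhamelMode hν hT k (b k - cosCube b k) := by
    have := congrArg (fun b' : ℓ¹(ℤ, C(Icc (0 : ℝ) T, ℝ)) => b' k) H
    exact this
  have h' := congrArg (fun f : C(Icc (0 : ℝ) T, ℝ) => f ⟨t, ht⟩) h
  simp only [ContinuousMap.add_apply, freeMode_apply, duhamelMode_apply] at h'
  rw [IccExtend_of_mem hT _ ht, h', ← relaxation_const_mul]
  simp only [relaxation]
  ring

theorem IsMildSolution.modeCoeff_eq (H : IsMildSolution hν hT a b) (k : ℤ) {t : ℝ}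
    (ht : t ∈ Icc 0 T) : modeCoeff hT b k t =
      a k / freqWeight k + ∫ s in (0 : ℝ)..t, modeRate ν hT b k s := by
  have hc : Continuous fun s => (k : ℝ) ^ 2 * IccExtend hT (b k - cosCube b k) s :=
    (continuous_IccExtend hT _).const_mul _
  have e : ∀ s, IccExtend hT (b k - cosCube b k) s
      = IccExtend hT (b k) s - IccExtend hT (cosCube b k) s := fun s => rfl
  rw [modeCoeff, H.apply_eq_relaxation k ht, relaxation_eq_integral _ _ hc, add_div,
    ← intervalIntegral.integral_div]
  congr 1
  refine intervalIntegral.integral_congr fun s hs => ?_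
  rw [uIcc_of_le ht.1] at hs
  simp only []
  rw [← H.apply_eq_relaxation k ⟨hs.1, hs.2.trans ht.2⟩, e, modeRate, modeCoeff, modeCoeff]
  ring

theorem IsMildSolution.modeCoeff_initial (H : IsMildSolution hν hT a b) (k : ℤ) :
    modeCoeff hT b k 0 = a k / freqWeight k := by
  simpa using H.modeCoeff_eq k (left_mem_Icc.2 hT)

/-- Every term of the rate has a factor `k`, so the mean slope is conserved. Its vanishing is what
makes the primitive in `x` periodic, and makes the value `y / 0 = 0` harmless in `mildPrimitive`. -/
theorem IsMildSolution.modeCoeff_zero_freq (H : IsMildSolution hν hT a b) (ha : a 0 = 0) {t : ℝ}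
    (ht : t ∈ Icc 0 T) : modeCoeff hT b 0 t = 0 := by
  rw [H.modeCoeff_eq 0 ht]
  simp [ha, modeRate]

/-- The primitive in `x` of a mild solution. -/
def mildPrimitive (hT : 0 ≤ T) (b : ℓ¹(ℤ, C(Icc (0 : ℝ) T, ℝ))) (t : ℝ) : ℝ → ℝ :=
  trigSeries (fun k => modeCoeff hT b k t / k) 0

theorem IsMildSolution.deriv_mildPrimitive (H : IsMildSolution hν hT a b) (ha : a 0 = 0) {t : ℝ}
    (ht : t ∈ Icc 0 T) (x : ℝ) : deriv (mildPrimitive hT b t) x = cosEval ⟨t, ht⟩ x b := by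
  rw [← iteratedDeriv_one, mildPrimitive, iteratedDeriv_trigSeries (n := 4)
    (fun j hj => summable_pow_mul_modeCoeff_div hT b t hj) (by norm_num), cosEval_eq_trigSeries hT]
  congr 1
  · funext k
    rcases eq_or_ne k 0 with rfl | hk
    · simp [H.modeCoeff_zero_freq ha ht]
    · have : (k : ℝ) ≠ 0 := by exact_mod_cast hk
      field_simp
  · simp

/-- The cubed slope is itself the cosine series of `cosCube b`, so the nonlinear term can be
differentiated termwise. The accumulated phases `π`, `π` and `2π` give the signs in `modeRate`. -/
theorem IsMildSolution.thinFilmRHS_mildPrimitive (H : IsMildSolution hν hT a b) (ha : a 0 = 0)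
    {t : ℝ} (ht : t ∈ Icc 0 T) (x : ℝ) : thinFilmRHS ν (mildPrimitive hT b t) x =
      ∑' k : ℤ, modeRate ν hT b k t / k * Real.sin (k * x) := by
  have hs := fun (j : ℕ) (hj : j ≤ 4) => summable_pow_mul_modeCoeff_div hT b t hj
  have hn := fun (j : ℕ) (hj : j ≤ 4) => summable_pow_mul_modeCoeff hT (cosCube b) t hj
  have hcube : (fun y => deriv (mildPrimitive hT b t) y ^ 3)
      = trigSeries (fun k => modeCoeff hT (cosCube b) k t) (Real.pi / 2) := by
    funext y
    rw [H.deriv_mildPrimitive ha ht, ← cosEval_cosCube, cosEval_eq_trigSeries]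
  have hd1 : HasDerivAt (fun y => deriv (mildPrimitive hT b t) y ^ 3)
      (trigSeries (fun k => k * modeCoeff hT (cosCube b) k t) (Real.pi / 2 + Real.pi / 2) x) x := by
    rw [hcube]
    exact hasDerivAt_trigSeries (by simpa using hn 0 (by norm_num))
      (by simpa using hn 1 (by norm_num)) _ x
  have hd2 : HasDerivAt (deriv (mildPrimitive hT b t)) (iteratedDeriv 2 (mildPrimitive hT b t) x)
      x := by
    have := hasDerivAt_iteratedDeriv_of_contDiff (contDiff_trigSeries hs) (j := 1) (by norm_num) x
    rwa [iteratedDeriv_one] at this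
  have hd := (hd1.sub hd2).deriv
  rw [thinFilmRHS]
  rw [show (fun y => deriv (mildPrimitive hT b t) y ^ 3 - deriv (mildPrimitive hT b t) y)
    = (fun y => deriv (mildPrimitive hT b t) y ^ 3) - deriv (mildPrimitive hT b t) from rfl, hd,
    mildPrimitive, iteratedDeriv_trigSeries hs (by norm_num),
    iteratedDeriv_trigSeries hs (by norm_num), trigSeries, trigSeries, trigSeries,
    ← (summable_trigSeries (by simpa using hn 1 (by norm_num)) _ _).tsum_sub
      (summable_trigSeries (hs 2 (by norm_num)) _ _), ← tsum_mul_left,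
    ← ((summable_trigSeries (by simpa using hn 1 (by norm_num)) _ _).sub
      (summable_trigSeries (hs 2 (by norm_num)) _ _)).tsum_sub
      ((summable_trigSeries (hs 4 (by norm_num)) _ _).mul_left _)]
  congr 1
  funext k
  have e1 : ∀ y : ℝ, Real.sin (y + (Real.pi / 2 + Real.pi / 2)) = -Real.sin y := fun y => by
    rw [add_halves, Real.sin_add_pi]
  have e2 : ∀ y : ℝ, Real.sin (y + (2 : ℕ) * (Real.pi / 2)) = -Real.sin y := fun y => by
    rw [← Real.sin_add_pi]
    congr 1
    push_cast
    ring
  have e4 : ∀ y : ℝ, Real.sin (y + (4 : ℕ) * (Real.pi / 2)) = Real.sin y := fun y => by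
    rw [← Real.sin_add_two_pi y]
    congr 1
    push_cast
    ring
  rw [e1, e2, e4, modeRate]
  rcases eq_or_ne k 0 with rfl | hk
  · simp
  · have : (k : ℝ) ≠ 0 := by exact_mod_cast hk
    field_simp
    ring

theorem IsMildSolution.isClassicalSolution (H : IsMildSolution hν hT a b) (ha : a 0 = 0) :
    IsClassicalSolution ν T (trigSeries (fun k => a k / freqWeight k / k) 0)
      (mildPrimitive hT b) where
  periodic t _ := periodic_trigSeries _ _
  contDiff t _ := by
    have := contDiff_trigSeries fun j hj => summable_pow_mul_modeCoeff_div hT b t (j := j) hj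
    exact_mod_cast this
  continuousOn j hj := by
    have h := continuous_trigSeries (d := fun k t => (k : ℝ) ^ j * (modeCoeff hT b k t / k))
      (fun k => ((continuous_modeCoeff hT b k).div_const _).const_mul _)
      (lp.hasSum_norm_one b).summable (fun k t => abs_pow_mul_modeCoeff_div_le hT b k t hj)
      (j * (Real.pi / 2))
    refine h.continuousOn.congr fun p _ => ?_
    simp only [mildPrimitive]
    rw [iteratedDeriv_trigSeries (n := 4)
      (fun j hj => summable_pow_mul_modeCoeff_div hT b p.1 hj) hj]
  equation t ht x := by
    have ht' : t ∈ Icc 0 T := ⟨ht.1, ht.2.le⟩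
    rw [H.thinFilmRHS_mildPrimitive ha ht']
    have hb0 := summable_pow_mul_modeCoeff_div hT b 0 (j := 0) (by norm_num)
    have h := hasDerivWithinAt_tsum_of_eq_integral (T := T)
      (C := fun (k : ℤ) t => modeCoeff hT b k t / k * Real.sin (k * x + 0))
      (r := fun (k : ℤ) t => modeRate ν hT b k t / k * Real.sin (k * x))
      (fun k => ((continuous_modeRate ν hT b k).div_const _).mul_const _)
      (summable_modeRate_bound ν b)
      (fun k t => (norm_mul_sin_le _ _).trans ((abs_div_intCast_le _ k).trans
        (abs_modeRate_le hν hT b k t)))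
      (summable_trigSeries (by simpa using hb0) 0 x) (fun k s hs => by
        rw [H.modeCoeff_eq k hs, H.modeCoeff_initial, add_zero,
          intervalIntegral.integral_mul_const, intervalIntegral.integral_div]
        ring) ht'
    -- As `t < T`, the set `[0, T]` is a neighbourhood of `t` within `[0, ∞)`.
    refine h.mono_of_mem_nhdsWithin ?_
    filter_upwards [self_mem_nhdsWithin, mem_nhdsWithin_of_mem_nhds (Iio_mem_nhds ht.2)]
      with s hs hs'
    exact ⟨hs, le_of_lt hs'⟩
  initial x := by
    simp only [mildPrimitive, H.modeCoeff_initial]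

theorem IsMildSolution.hasDerivWithinAt_tsum_modeCoeff (H : IsMildSolution hν hT a b) {t : ℝ}
    (ht : t ∈ Icc 0 T) : HasDerivWithinAt (fun t => ∑' k : ℤ, modeCoeff hT b k t)
      (∑' k : ℤ, modeRate ν hT b k t) (Icc 0 T) t := by
  have h0 := (summable_pow_mul_modeCoeff hT b 0 (j := 0) (by norm_num)).of_abs
  exact hasDerivWithinAt_tsum_of_eq_integral (continuous_modeRate ν hT b)
    (summable_modeRate_bound ν b) (abs_modeRate_le hν hT b) (by simpa using h0)
    (fun k s hs => by rw [H.modeCoeff_eq k hs, H.modeCoeff_initial]) ht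

end Regularity

/-! ### The flat-topped profile and the growth of its slope. -/

section SlopeGrowth

/-- A point value says nothing about an essential supremum by itself; continuity makes `f > 1` on a
nonempty open subset of the fundamental domain, which has positive measure. -/
theorem one_lt_torusLInfNorm {f : ℝ → ℝ} (hf : Continuous f) (h0 : 1 < f 0) :
    1 < torusLInfNorm f := by
  by_contra! hle
  rw [torusLInfNorm, eLpNorm_exponent_top] at hle
  have hae : ∀ᵐ x ∂(volume.restrict (Ioc (-Real.pi) Real.pi)), ‖f x‖ₑ ≤ 1 :=
    (ae_le_eLpNormEssSup (f := f)).mono fun x hx => hx.trans hle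
  rw [ae_restrict_iff' measurableSet_Ioc] at hae
  set U := {x | 1 < f x} ∩ Ioo (-Real.pi) Real.pi with hU
  have hUo : IsOpen U := (isOpen_lt continuous_const hf).inter isOpen_Ioo
  have hUn : U.Nonempty := ⟨0, h0, by simp [Real.pi_pos], Real.pi_pos⟩
  rw [ae_iff] at hae
  refine (hUo.measure_pos volume hUn).ne' (measure_mono_null ?_ hae)
  intro x hx hx'
  have h1 : ‖f x‖ₑ ≤ 1 := hx' (Ioo_subset_Ioc_self hx.2)
  have h2 : ‖f x‖ ≤ 1 := by
    rw [← ofReal_norm] at h1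
    exact ENNReal.ofReal_le_one.1 h1
  exact absurd ((le_abs_self (f x)).trans h2) (not_le.2 hx.1)

theorem torusLInfNorm_le {f : ℝ → ℝ} {C : ℝ} (hf : ∀ x, |f x| ≤ C) :
    torusLInfNorm f ≤ ENNReal.ofReal C := by
  rw [torusLInfNorm, eLpNorm_exponent_top]
  exact eLpNormEssSup_le_of_ae_bound (ae_of_all _ hf)

/-- A function whose slope `(9 cos x - cos 3x) / 8` has its maximum `1` at `0`, where the second
derivative of the slope vanishes and the fourth is negative. -/
def flatSlopeProfile (x : ℝ) : ℝ := (9 * Real.sin x - Real.sin (3 * x) / 3) / 8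

theorem hasDerivAt_sin_three_mul (x : ℝ) :
    HasDerivAt (fun x => Real.sin (3 * x)) (3 * Real.cos (3 * x)) x := by
  have h : HasDerivAt (fun x : ℝ => 3 * x) 3 x := by simpa using (hasDerivAt_id x).const_mul (3 : ℝ)
  simpa [mul_comm] using h.sin

theorem hasDerivAt_cos_three_mul (x : ℝ) :
    HasDerivAt (fun x => Real.cos (3 * x)) (-(3 * Real.sin (3 * x))) x := by
  have h : HasDerivAt (fun x : ℝ => 3 * x) 3 x := by simpa using (hasDerivAt_id x).const_mul (3 : ℝ)
  simpa [mul_comm] using h.cos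

theorem hasDerivAt_flatSlopeProfile (x : ℝ) :
    HasDerivAt flatSlopeProfile ((9 * Real.cos x - Real.cos (3 * x)) / 8) x := by
  refine ((((Real.hasDerivAt_sin x).const_mul 9).sub
    ((hasDerivAt_sin_three_mul x).div_const 3)).div_const 8).congr_deriv ?_
  ring

/-- With `c = cos x` the slope is `(3c - c³) / 2`, and its distances to `1` and `-1` are `(c - 1)²(c
+ 2) / 2` and `(c + 1)²(2 - c) / 2`. -/
theorem abs_flatSlope_le_one (x : ℝ) : |(9 * Real.cos x - Real.cos (3 * x)) / 8| ≤ 1 := by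
  rw [Real.cos_three_mul, abs_le]
  have h1 := Real.neg_one_le_cos x
  have h2 := Real.cos_le_one x
  generalize Real.cos x = c at h1 h2 ⊢
  constructor
  · nlinarith [mul_nonneg (sq_nonneg (c + 1)) (by linarith : 0 ≤ 2 - c)]
  · nlinarith [mul_nonneg (sq_nonneg (c - 1)) (by linarith : 0 ≤ 2 + c)]

theorem contDiff_flatSlopeProfile : ContDiff ℝ ∞ flatSlopeProfile := by
  unfold flatSlopeProfile
  fun_prop

theorem periodic_flatSlopeProfile : Function.Periodic flatSlopeProfile (2 * Real.pi) := by
  intro x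
  have h := Real.sin_add_int_mul_two_pi (3 * x) 3
  push_cast at h
  simp only [flatSlopeProfile, Real.sin_add_two_pi]
  rw [show 3 * (x + 2 * Real.pi) = 3 * x + 3 * (2 * Real.pi) by ring, h]

theorem flatSlopeProfile_neg (x : ℝ) : flatSlopeProfile (-x) = -flatSlopeProfile x := by
  simp only [flatSlopeProfile, mul_neg, Real.sin_neg]
  ring

theorem integral_flatSlopeProfile : ∫ x in (-Real.pi)..Real.pi, flatSlopeProfile x = 0 := by
  have h := intervalIntegral.integral_comp_neg (a := -Real.pi) (b := Real.pi) flatSlopeProfile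
  simp only [flatSlopeProfile_neg, intervalIntegral.integral_neg, neg_neg] at h
  linarith

theorem flatSlopeProfile_pi_div_two : flatSlopeProfile (Real.pi / 2) = 7 / 6 := by
  have : Real.sin (3 * (Real.pi / 2)) = -1 := by
    rw [show 3 * (Real.pi / 2) = Real.pi / 2 + Real.pi by ring, Real.sin_add_pi,
      Real.sin_pi_div_two]
  rw [flatSlopeProfile, this, Real.sin_pi_div_two]
  norm_num

/-- The weighted cosine coefficients of the slope of `flatSlopeProfile`. -/
def flatSlopeCoeff : ℓ¹(ℤ, ℝ) :=
  lp.single 1 1 (freqWeight 1 * (9 / 8)) + lp.single 1 3 (freqWeight 3 * (-1 / 8))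

theorem flatSlopeCoeff_zero : flatSlopeCoeff 0 = 0 := by
  simp [flatSlopeCoeff]

theorem smul_flatSlopeCoeff_apply (s : ℝ) (k : ℤ) : (s • flatSlopeCoeff) k =
    s * ((if k = 1 then freqWeight 1 * (9 / 8) else 0)
      + if k = 3 then freqWeight 3 * (-1 / 8) else 0) := by
  change s * ((Pi.single 1 (freqWeight 1 * (9 / 8)) : ℤ → ℝ) k
    + (Pi.single 3 (freqWeight 3 * (-1 / 8)) : ℤ → ℝ) k) = _
  rw [Pi.single_apply, Pi.single_apply]

theorem hasSum_flatSlopeCoeff (s : ℝ) (g : ℤ → ℝ) :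
    HasSum (fun k => (s • flatSlopeCoeff) k / freqWeight k * g k)
      (s * (9 / 8 * g 1 - 1 / 8 * g 3)) := by
  have h : ∀ k ∉ ({1, 3} : Finset ℤ), (s • flatSlopeCoeff) k / freqWeight k * g k = 0 := by
    intro k hk
    simp only [Finset.mem_insert, Finset.mem_singleton, not_or] at hk
    simp [smul_flatSlopeCoeff_apply, hk.1, hk.2]
  have h1 := (freqWeight_pos 1).ne'
  have h3 := (freqWeight_pos 3).ne'
  have e : ∑ k ∈ ({1, 3} : Finset ℤ), (s • flatSlopeCoeff) k / freqWeight k * g k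
      = s * (9 / 8 * g 1 - 1 / 8 * g 3) := by
    rw [Finset.sum_pair (by norm_num)]
    rw [smul_flatSlopeCoeff_apply, smul_flatSlopeCoeff_apply]
    norm_num
    field_simp
    ring
  rw [← e]
  exact hasSum_sum_of_ne_finset_zero h

theorem trigSeries_flatSlopeCoeff (s : ℝ) :
    trigSeries (fun k => (s • flatSlopeCoeff) k / freqWeight k / k) 0
      = fun x => s * flatSlopeProfile x := by
  funext x
  have h := (hasSum_flatSlopeCoeff s fun k => Real.sin (k * x + 0) / k).tsum_eq
  rw [trigSeries, flatSlopeProfile]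
  convert! h using 1
  · congr 1
    funext k
    ring
  · push_cast
    simp only [add_zero, one_mul, div_one]
    ring

variable {ν T : ℝ} {hν : 0 < ν} {hT : 0 ≤ T} {b : ℓ¹(ℤ, C(Icc (0 : ℝ) T, ℝ))}

theorem IsMildSolution.cosEval_initial (H : IsMildSolution hν hT flatSlopeCoeff b) (x : ℝ) :
    cosEval ⟨0, left_mem_Icc.2 hT⟩ x b = (9 * Real.cos x - Real.cos (3 * x)) / 8 := by
  rw [cosEval_eq_trigSeries hT, trigSeries]
  have h := (hasSum_flatSlopeCoeff 1 fun k => Real.sin (k * x + Real.pi / 2)).tsum_eq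
  rw [one_smul] at h
  simp only [H.modeCoeff_initial]
  rw [h]
  simp only [Real.sin_add_pi_div_two]
  push_cast
  ring_nf

/-- The sum is `-(q³)''(0) = -(3 q² q'' + 6 q q'²)(0)`, and both `q'` and `q''` vanish at `0`. -/
theorem IsMildSolution.tsum_sq_mul_modeCoeff_cosCube
    (H : IsMildSolution hν hT flatSlopeCoeff b) :
    ∑' k : ℤ, (k : ℝ) ^ 2 * modeCoeff hT (cosCube b) k 0 = 0 := by
  have hn := fun (j : ℕ) (hj : j ≤ 4) => summable_pow_mul_modeCoeff hT (cosCube b) 0 hj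
  set q : ℝ → ℝ := fun x => (9 * Real.cos x - Real.cos (3 * x)) / 8 with hq
  set q' : ℝ → ℝ := fun x => (-9 * Real.sin x + 3 * Real.sin (3 * x)) / 8 with hq'
  have dq : ∀ x, HasDerivAt q (q' x) x := fun x => by
    refine ((((Real.hasDerivAt_cos x).const_mul 9).sub
      (hasDerivAt_cos_three_mul x)).div_const 8).congr_deriv ?_
    simp only [hq']
    ring
  have dq' : HasDerivAt q' 0 0 := by
    refine ((((Real.hasDerivAt_sin 0).const_mul (-9)).add
      ((hasDerivAt_sin_three_mul 0).const_mul 3)).div_const 8).congr_deriv ?_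
    norm_num
  have e0 : trigSeries (fun k => modeCoeff hT (cosCube b) k 0) (Real.pi / 2) = q ^ 3 := by
    funext x
    rw [← cosEval_eq_trigSeries hT (b := cosCube b) (left_mem_Icc.2 hT), cosEval_cosCube,
      H.cosEval_initial]
    rfl
  have e1 : trigSeries (fun k => k * modeCoeff hT (cosCube b) k 0) (Real.pi / 2 + Real.pi / 2)
      = 3 • q ^ 2 * q' := by
    funext x
    have h := hasDerivAt_trigSeries (by simpa using hn 0 (by norm_num))
      (by simpa using hn 1 (by norm_num)) (Real.pi / 2) x
    rw [e0] at h
    refine h.unique (((dq x).pow 3).congr_deriv ?_)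
    simp
  have h2 := hasDerivAt_trigSeries (d := fun k => k * modeCoeff hT (cosCube b) k 0)
    (by simpa using hn 1 (by norm_num))
    ((hn 2 (by norm_num)).congr fun k => by ring_nf) (Real.pi / 2 + Real.pi / 2) 0
  rw [e1] at h2
  have h3 := h2.unique ((((dq 0).pow 2).const_smul 3).mul dq')
  have hq0 : q' 0 = 0 := by simp [hq']
  simp only [hq0, mul_zero, smul_zero, add_zero] at h3
  have e : ∀ k : ℤ, (k : ℝ) * (k * modeCoeff hT (cosCube b) k 0)
      * Real.sin (k * 0 + (Real.pi / 2 + Real.pi / 2 + Real.pi / 2))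
      = -((k : ℝ) ^ 2 * modeCoeff hT (cosCube b) k 0) := fun k => by
    rw [add_halves, mul_zero, zero_add, add_comm, Real.sin_add_pi, Real.sin_pi_div_two]
    ring
  rw [trigSeries, tsum_congr e, tsum_neg] at h3
  linarith

/-- The coefficients `9/8` and `-1/8` at frequencies `1` and `3` cancel in the `k²` sum; the `k⁴`
sum is `9/8 - 81/8 = -9`, leaving only the contribution of the fourth-order term. -/
theorem IsMildSolution.tsum_modeRate_initial (H : IsMildSolution hν hT flatSlopeCoeff b) :
    ∑' k : ℤ, modeRate ν hT b k 0 = 9 * ν := by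
  have h := hasSum_flatSlopeCoeff 1 fun k => -ν * (k : ℝ) ^ 4 + (k : ℝ) ^ 2
  rw [one_smul] at h
  have hn := (summable_pow_mul_modeCoeff hT (cosCube b) 0 (j := 2) (by norm_num)).of_abs
  have e : ∀ k : ℤ, modeRate ν hT b k 0 =
      flatSlopeCoeff k / freqWeight k * (-ν * (k : ℝ) ^ 4 + (k : ℝ) ^ 2)
        - (k : ℝ) ^ 2 * modeCoeff hT (cosCube b) k 0 := fun k => by
    rw [modeRate, H.modeCoeff_initial]
    ring
  rw [tsum_congr e, h.summable.tsum_sub hn, h.tsum_eq, H.tsum_sq_mul_modeCoeff_cosCube]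
  push_cast
  ring

/-- The slope at the origin exceeds `1` at some positive time. -/
theorem IsMildSolution.exists_one_lt_cosEval (hT' : 0 < T)
    (H : IsMildSolution hν hT flatSlopeCoeff b) :
    ∃ (t : ℝ) (ht : t ∈ Icc 0 T), 0 < t ∧ t < T ∧ 1 < cosEval ⟨t, ht⟩ 0 b := by
  have hU : ∀ (t : ℝ) (ht : t ∈ Icc 0 T), cosEval ⟨t, ht⟩ 0 b = ∑' k, modeCoeff hT b k t := by
    intro t ht
    rw [cosEval_eq_trigSeries hT, trigSeries]
    simp
  have hd := H.hasDerivWithinAt_tsum_modeCoeff (left_mem_Icc.2 hT)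
  rw [H.tsum_modeRate_initial] at hd
  have h0 : ∑' k, modeCoeff hT b k 0 = 1 := by
    rw [← hU 0 (left_mem_Icc.2 hT), H.cosEval_initial]
    norm_num
  -- The difference quotients at `0` tend to `9ν > 0`, so some later slope exceeds its initial value
  -- `1`.
  have hs := (hasDerivWithinAt_iff_tendsto_slope' (by simp)).1 (hd.mono Ioo_subset_Icc_self)
  rw [nhdsWithin_Ioo_eq_nhdsGT hT'] at hs
  obtain ⟨t, hpos, ht⟩ := ((hs.eventually_const_lt (by positivity : 0 < 9 * ν)).and
    (Ioo_mem_nhdsGT hT')).exists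
  refine ⟨t, Ioo_subset_Icc_self ht, ht.1, ht.2, ?_⟩
  rw [slope_def_field, h0, sub_zero] at hpos
  rw [hU]
  have := (div_pos_iff_of_pos_right ht.1).1 hpos
  linarith

end SlopeGrowth

end

/-! ### Perturbation to initial slopes below one. -/

theorem theorem1p4 (ν : ℝ) (hν : 0 < ν) :
    ∃ A : Set (ℝ → ℝ), A.Infinite ∧
      ∀ h₀ ∈ A,
        (ContDiff ℝ ∞ h₀ ∧ Function.Periodic h₀ (2 * Real.pi)) ∧
        (∫ x in (-Real.pi)..Real.pi, h₀ x = 0) ∧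
        torusLInfNorm (deriv h₀) < 1 ∧
        ∃ t₀ : ℝ, 0 < t₀ ∧
          (∃ T : ℝ, t₀ < T ∧ ∃ h : ℝ → ℝ → ℝ, IsClassicalSolution ν T h₀ h) ∧
          (∀ T : ℝ, t₀ < T → ∀ h : ℝ → ℝ → ℝ, IsClassicalSolution ν T h₀ h →
            1 < torusLInfNorm (deriv (h t₀))) := by
  set M := ‖flatSlopeCoeff‖ with hM
  have hM0 : 0 ≤ M := norm_nonneg _
  obtain ⟨T, hT, sol, hsol⟩ := exists_isMildSolution hν M
  obtain ⟨t₀, ht₀, ht₀pos, ht₀T, hgt⟩ := (hsol flatSlopeCoeff le_rfl).1.exists_one_lt_cosEval hT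
  set η := cosEval ⟨t₀, ht₀⟩ 0 (sol flatSlopeCoeff) - 1 with hη
  have hη0 : 0 < η := by linarith
  -- Replacing the profile by its multiple `s` moves the slope at `(t₀, 0)` by at most `2 (1 - s)
  -- M`, which must stay below the excess `η`. Using `M + 1` avoids dividing by zero, and the
  -- maximum with `0` keeps `s` positive.
  set s₀ := max 0 (1 - η / (2 * (M + 1))) with hs₀
  have hs₀1 : s₀ < 1 := max_lt one_pos (by linarith [show 0 < η / (2 * (M + 1)) by positivity])
  refine ⟨(fun (s : ℝ) (x : ℝ) => s * flatSlopeProfile x) '' Ioo s₀ 1,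
    (Ioo_infinite hs₀1).image fun s _ s' _ h => ?_, ?_⟩
  · have := congrFun h (Real.pi / 2)
    simpa [flatSlopeProfile_pi_div_two] using this
  · rintro _ ⟨s, ⟨hs, hs1⟩, rfl⟩
    have hs0 : 0 < s := (le_max_left _ _).trans_lt hs
    have hsη : 1 - η / (2 * (M + 1)) < s := (le_max_right _ _).trans_lt hs
    have hsM : ‖s • flatSlopeCoeff‖ ≤ M := by
      rw [norm_smul, Real.norm_of_nonneg hs0.le]
      exact mul_le_of_le_one_left hM0 hs1.le
    obtain ⟨hmild, hdiff⟩ := hsol (s • flatSlopeCoeff) hsM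
    have ha0 : (s • flatSlopeCoeff) 0 = 0 := by
      rw [lp.coeFn_smul, Pi.smul_apply, flatSlopeCoeff_zero, smul_zero]
    have hclass := hmild.isClassicalSolution ha0
    rw [trigSeries_flatSlopeCoeff] at hclass
    refine ⟨⟨contDiff_const.mul contDiff_flatSlopeProfile, fun x => ?_⟩, ?_, ?_, t₀, ht₀pos,
      ⟨T, ht₀T, _, hclass⟩, fun T' hT' h hh => ?_⟩
    · simp only [periodic_flatSlopeProfile x]
    · rw [intervalIntegral.integral_const_mul, integral_flatSlopeProfile, mul_zero]
    · refine (torusLInfNorm_le (C := s) fun x => ?_).trans_lt (ENNReal.ofReal_lt_one.2 hs1)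
      rw [((hasDerivAt_flatSlopeProfile x).const_mul s).deriv, abs_mul, abs_of_pos hs0]
      exact mul_le_of_le_one_right hs0.le (abs_flatSlope_le_one x)
    -- Uniqueness identifies an arbitrary solution at `t₀` with the constructed one, whose slope is
    -- known.
    · have e := hh.unique hν hclass ht₀pos.le hT' ht₀T
      have hcont : Continuous (deriv (h t₀)) :=
        (hh.contDiff t₀ ⟨ht₀pos.le, hT'⟩).continuous_deriv (by norm_num)
      refine one_lt_torusLInfNorm hcont ?_
      rw [e, hmild.deriv_mildPrimitive ha0 ht₀]
      have h1 := (abs_cosEval_le ⟨t₀, ht₀⟩ 0 (sol (s • flatSlopeCoeff) - sol flatSlopeCoeff)).trans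
        (hdiff flatSlopeCoeff le_rfl)
      have h2 : ‖s • flatSlopeCoeff - flatSlopeCoeff‖ = (1 - s) * M := by
        rw [← neg_sub, norm_neg]
        nth_rw 1 [← one_smul ℝ flatSlopeCoeff]
        rw [← sub_smul, norm_smul, Real.norm_of_nonneg (by linarith)]
      have h3 : (1 - s) * (2 * (M + 1)) < η := by
        rw [← lt_div_iff₀ (by positivity)]
        linarith
      rw [h2, map_sub] at h1
      have h4 := (abs_le.1 h1).1
      nlinarith
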